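/- **Setting.** Let $\mu$ be a $\sigma$-finite measure on a measurable space $\mathcal X$, let $\Theta\subseteq\mathbb R^d$, and let $\{P_\theta\}_{\theta\in\Theta}$ be probability distributions on $\mathcal X$ with densities $p_\theta$ with respect to $\mu$. Write $S_\theta(x)=\nabla_\theta\log p_\theta(x)$ for the score, where $\nabla_\theta$ is the vector of partial derivatives $\partial/\partial\theta_j$. Let $X_1,\dots,X_n$ be i.i.d. with distribution $P_\theta$, held by $n$ nodes. The nodes communicate over a public blackboard in $T$ rounds. In round $t=1,\dots,T$ the nodes $i=1,\dots,n$ write, one after the other, messages $Y_{i,t}$, where $Y_{i,t}$ is drawn from a channel with conditional density $p(y_{i,t}\mid x_i,y_{i-1,t},\dots,y_{1,t},\pi_{t-1},\dots,\pi_1)$ with respect to a $\sigma$-finite measure $\nu_{i,t}$; here $\pi_t=(y_{1,t},\dots,y_{n,t})$. The transcript is $\Pi=(\Pi_1,\dots,\Pi_T)$ with $\Pi_t=(Y_{1,t},\dots,Y_{n,t})$. With respect to $\nu=\bigotimes_{i,t}\nu_{i,t}$ it has the conditional density $$p(\pi\mid x_1,\dots,x_n)=\prod_{t=1}^T\prod_{i=1}^n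 p(y_{i,t}\mid x_i,y_{i-1,t},\dots,y_{1,t},\pi_{t-1},\dots,\pi_1)$$ and the density $p_\theta(\pi)=\int p(\pi\mid x_1,\dots,x_n)\prod_{i=1}^n p_\theta(x_i)\,d\mu(x_1)\cdots d\mu(x_n)$. Let $$I_\Pi(\theta)=\mathbb E\big[(\nabla_\theta\log p_\theta(\Pi))(\nabla_\theta\log p_\theta(\Pi))^{T}\big]$$ be the Fisher information matrix of the transcript, and let $I_\theta(X_1,\dots,X_n;\Pi)\in[0,\infty]$ be the mutual information (in nats) between $(X_1,\dots,X_n)$ and $\Pi$ under the parameter $\theta$. **Regularity conditions.** 1. For $\mu$-almost all $x$, the function $\theta\mapsto\sqrt{p_\theta(x)}$ is continuously differentiable with respect to each component $\theta_j$ on the interior of $\Theta$. 2. On the interior of $\Theta$, for each $j$, the Fisher information $\mathbb E\big[(\tfrac{\partial}{\partial\theta_j}\log p_\theta(X))^2\big]$, $X\sim P_\theta$, exists, is finite, and is a continuous function of $\theta_j$. 3. For each $\theta\in\Theta$, $\int p(\pi\mid x_1,\dots,x_n)^2\prod_{i=1}^n p_\theta(x_i)\,d\mu(x_1)\cdots d\mu(x_n)<\infty$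 for $\nu$-almost all $\pi$. **Statement.** Assume conditions 1–3. Let $\theta$ be an interior point of $\Theta$ and let $N\ge 0$ be such that, for $X\sim P_\theta$, $\langle u,S_\theta(X)\rangle$ is sub-Gaussian with parameter $N$ for every unit vector $u\in\mathbb R^d$, i.e. $\mathbb E\big[e^{\lambda\langle u,S_\theta(X)\rangle}\big]\le e^{\lambda^2N^2/2}$ for all $\lambda\in\mathbb R$. Then $\nabla_\theta\log p_\theta(\Pi)$ exists almost surely, the entries of $I_\Pi(\theta)$ are finite, and $$\mathsf{Tr}(I_\Pi(\theta))\le 2N^2\,I_\theta(X_1,\dots,X_n;\Pi),$$ with the convention $0\cdot\infty=0$ on the right-hand side. -/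

import Mathlib

open MeasureTheory ProbabilityTheory
open scoped ENNReal NNReal

/-! ### Statistical models, score, Fisher information -/

/-- A family `{P_θ}` of probability distributions on `𝒳` with parameter `θ ∈ Θ ⊆ ℝ^d`, given by
densities `p θ` with respect to `μ`. (Values of `p θ` for `θ ∉ Θ` carry no information.) -/
structure StatModel (d : ℕ) {𝒳 : Type*} [MeasurableSpace 𝒳] (μ : Measure 𝒳) where
  Θ : Set (EuclideanSpace ℝ (Fin d))
  p : EuclideanSpace ℝ (Fin d) → 𝒳 → ℝ
  measurable_p : ∀ θ ∈ Θ, Measurable (p θ)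
  nonneg_p : ∀ θ ∈ Θ, ∀ x, 0 ≤ p θ x
  lintegral_p : ∀ θ ∈ Θ, ∫⁻ x, ENNReal.ofReal (p θ x) ∂μ = 1

/-- The vector `∇_θ log f(θ)`, as the vector of the partial derivatives. -/
noncomputable def gradLog {d : ℕ} (f : EuclideanSpace ℝ (Fin d) → ℝ)
    (θ : EuclideanSpace ℝ (Fin d)) : EuclideanSpace ℝ (Fin d) :=
  WithLp.toLp 2 fun j => lineDeriv ℝ (fun θ' => Real.log (f θ')) θ (EuclideanSpace.single j 1)

/-- The Fisher information matrix `E[(∇_θ log f_θ(A)) (∇_θ log f_θ(A))ᵀ]` at `θ`, where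
`f θ` is the density of an observation `A` and `ρ` is the law of `A` under the parameter `θ`. -/
noncomputable def fisherInfo {d : ℕ} {α : Type*} [MeasurableSpace α]
    (f : EuclideanSpace ℝ (Fin d) → α → ℝ) (ρ : Measure α) (θ : EuclideanSpace ℝ (Fin d)) :
    Matrix (Fin d) (Fin d) ℝ :=
  Matrix.of fun j k =>
    ∫ a, gradLog (fun θ' => f θ' a) θ j * gradLog (fun θ' => f θ' a) θ k ∂ρ

/-- Mutual information of the two components of a pair with joint law `ρ`: the Kullback-Leibler
divergence of the joint law from the product of the marginals (natural logarithm). -/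
noncomputable def mutualInfo {α β : Type*} [MeasurableSpace α] [MeasurableSpace β]
    (ρ : Measure (α × β)) : ℝ≥0∞ :=
  InformationTheory.klDiv ρ (ρ.fst.prod ρ.snd)

namespace StatModel

variable {d : ℕ} {𝒳 : Type*} [MeasurableSpace 𝒳] {μ : Measure 𝒳}

/-- The distribution `P_θ`. -/
noncomputable def law (M : StatModel d μ) (θ : EuclideanSpace ℝ (Fin d)) : Measure 𝒳 :=
  μ.withDensity fun x => ENNReal.ofReal (M.p θ x)

/-- The score `S_θ(x) = ∇_θ log p_θ(x)`. -/
noncomputable def score (M : StatModel d μ) (θ : EuclideanSpace ℝ (Fin d)) (x : 𝒳) :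
    EuclideanSpace ℝ (Fin d) :=
  gradLog (fun θ' => M.p θ' x) θ

/-- Regularity condition (i): for `μ`-almost all `x`, the square-root density is continuously
differentiable with respect to each component of the parameter. -/
def RegularSqrt (M : StatModel d μ) : Prop :=
  ∀ᵐ x ∂μ, ∀ θ ∈ interior M.Θ, ∀ j : Fin d,
    ContDiffAt ℝ 1 (fun t : ℝ => √(M.p (θ + t • EuclideanSpace.single j 1) x)) 0

/-- Regularity condition (ii): for each component `θ_j` the Fisher information exists and is a
continuous function of `θ_j`. -/
def RegularFisher (M : StatModel d μ) : Prop :=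
  ∀ θ ∈ interior M.Θ, ∀ j : Fin d,
    Integrable (fun x => (M.score θ x j) ^ 2) (M.law θ) ∧
    ContinuousAt (fun t : ℝ =>
      ∫ x, (M.score (θ + t • EuclideanSpace.single j 1) x j) ^ 2
        ∂(M.law (θ + t • EuclideanSpace.single j 1))) 0

end StatModel

/-! ### Interactive blackboard protocols -/

/-- An interactive protocol with `n` nodes and `T` rounds. The messages are indexed by pairs
`s = (t, i)` (round, node) in lexicographic order, the message at `s` takes values in `𝒴 s`.
`chan s x h y` is the density at `y`, with respect to `ν s`, of the message written at `s` when the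
node that speaks holds the sample `x` and the blackboard shows the history `h`, i.e. all the
messages of the earlier rounds and those of the preceding nodes in the current round. -/
structure BlackboardProtocol (𝒳 : Type*) [MeasurableSpace 𝒳] (n T : ℕ)
    (𝒴 : Fin T ×ₗ Fin n → Type*) [∀ s, MeasurableSpace (𝒴 s)] (ν : ∀ s, Measure (𝒴 s)) where
  chan : ∀ s, 𝒳 → (∀ r : {r : Fin T ×ₗ Fin n // r < s}, 𝒴 r) → 𝒴 s → ℝ
  measurable_chan : ∀ s, Measurable
    fun z : 𝒳 × (∀ r : {r : Fin T ×ₗ Fin n // r < s}, 𝒴 r) × 𝒴 s => chan s z.1 z.2.1 z.2.2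
  nonneg_chan : ∀ s x h y, 0 ≤ chan s x h y
  lintegral_chan : ∀ s x h, ∫⁻ y, ENNReal.ofReal (chan s x h y) ∂(ν s) = 1

namespace BlackboardProtocol

variable {d n T : ℕ} {𝒳 : Type*} [MeasurableSpace 𝒳] {μ : Measure 𝒳}
  {𝒴 : Fin T ×ₗ Fin n → Type*} [∀ s, MeasurableSpace (𝒴 s)] {ν : ∀ s, Measure (𝒴 s)}

/-- The conditional density `p(π | x_1, …, x_n)` of the whole transcript given the samples, with
respect to the product of the measures `ν s`. -/
noncomputable def transcriptChan (C : BlackboardProtocol 𝒳 n T 𝒴 ν) (x : Fin n → 𝒳)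
    (π : ∀ s, 𝒴 s) : ℝ :=
  ∏ s : Fin T ×ₗ Fin n, C.chan s (x (ofLex s).2) (fun r => π r) (π s)

/-- The joint law of `((X_1, …, X_n), Π)` when the `X_i` are i.i.d. with distribution `P_θ`. -/
noncomputable def jointLaw (C : BlackboardProtocol 𝒳 n T 𝒴 ν) (M : StatModel d μ)
    (θ : EuclideanSpace ℝ (Fin d)) : Measure ((Fin n → 𝒳) × (∀ s, 𝒴 s)) :=
  ((Measure.pi fun _ : Fin n => M.law θ).prod (Measure.pi ν)).withDensity
    fun z => ENNReal.ofReal (C.transcriptChan z.1 z.2)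

/-- The law of the transcript `Π` under the parameter `θ`. -/
noncomputable def transcriptLaw (C : BlackboardProtocol 𝒳 n T 𝒴 ν) (M : StatModel d μ)
    (θ : EuclideanSpace ℝ (Fin d)) : Measure (∀ s, 𝒴 s) :=
  (C.jointLaw M θ).snd

/-- The density `p_θ(π) = ∫ p(π | x_1, …, x_n) p_θ(x_1) ⋯ p_θ(x_n) dμ(x_1) ⋯ dμ(x_n)` of the
transcript. -/
noncomputable def transcriptDensity (C : BlackboardProtocol 𝒳 n T 𝒴 ν) (M : StatModel d μ)
    (θ : EuclideanSpace ℝ (Fin d)) (π : ∀ s, 𝒴 s) : ℝ :=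
  ∫ x, C.transcriptChan x π * ∏ i, M.p θ (x i) ∂(Measure.pi fun _ : Fin n => μ)

/-- Regularity condition (iii), for the channel from the samples to the transcript: for each `θ`,
`∫ p(π | x_1, …, x_n)² p_θ(x_1) ⋯ p_θ(x_n) dμ(x_1) ⋯ dμ(x_n) < ∞` at almost all `π`. -/
def SquareIntegrable (C : BlackboardProtocol 𝒳 n T 𝒴 ν) (M : StatModel d μ) : Prop :=
  ∀ θ ∈ M.Θ, ∀ᵐ π ∂(Measure.pi ν),
    Integrable (fun x => (C.transcriptChan x π) ^ 2 * ∏ i, M.p θ (x i))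
      (Measure.pi fun _ : Fin n => μ)

/-- The Fisher information matrix `I_Π(θ)` for estimating `θ` from the transcript. -/
noncomputable def transcriptFisher (C : BlackboardProtocol 𝒳 n T 𝒴 ν) (M : StatModel d μ)
    (θ : EuclideanSpace ℝ (Fin d)) : Matrix (Fin d) (Fin d) ℝ :=
  fisherInfo (C.transcriptDensity M) (C.transcriptLaw M θ) θ

end BlackboardProtocol

/-! The score of the transcript is the posterior mean of the score of the sample: `∂_j log p_θ(π) =
∑ i, V i j π`, where `V i j π` is the mean of the `j`-th coordinate of `S_θ(X_i)` given `Π = π`. For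
a fixed transcript the channel density is a product of one factor per node, so the `X_i` remain
independent given `π`. Since scores have mean zero, `E[V i j * V l j] = 0` for `i ≠ l`
(`integral_postMean_mul_postMean`), and the trace of the Fisher information equals `D = ∑ i j, E[(V
i j)²]`.

The bound on `D` is a transport-type inequality (`sum_integral_sq_sum_postMean_le`). The
Donsker–Varadhan inequality is applied to the joint law against the product of its marginals, with
test function `∑ i, (⟨w_i, S_θ(X_i)⟩ - N² ‖w_i‖² / 2)` and `w_i = V i / N²`. Under the product law,
`π` can be frozen, and sub-Gaussianity makes the exponential moment at most one. Under the joint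
law, the tower property gives the mean `D / (2N²)`, hence `D / (2N²) ≤ I(X; Π)`.

The analytic difficulty is differentiating `p_θ(π) = ∫ c U_t²` under the integral, where `U_t` is
the square root of the product density. Square integrability of the channel is used only at the base
parameter, so no dominating function is at hand. Instead `U_t² = U_0² + 2 U_0 (U_t - U_0) + (U_t -
U_0)²` is expanded (`ae_hasDerivAt_integral_mul_sq`). The linear term converges because `c U_0` lies
in `L²` and the difference quotients of `U`, bounded in `L²`, converge pointwise. The quadratic term
is `o(t)` for almost every `π`, by Tonelli and the unit mass of the channel. The bounded curve comes
from continuity of the Fisher information (`StatModel.exists_sqrt_curve`). -/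

open Filter Topology

/-! ### General facts -/

/-- The Donsker–Varadhan (Gibbs) lower bound on the Kullback–Leibler divergence. -/
theorem ofReal_integral_le_klDiv {α : Type*} [MeasurableSpace α] (ρ κ : Measure α)
    [IsProbabilityMeasure ρ] [IsProbabilityMeasure κ] {φ : α → ℝ} (hφm : Measurable φ)
    (hφ : Integrable φ ρ) (hexp : ∫⁻ a, ENNReal.ofReal (Real.exp (φ a)) ∂κ ≤ 1) :
    ENNReal.ofReal (∫ a, φ a ∂ρ) ≤ InformationTheory.klDiv ρ κ := by
  by_cases htop : InformationTheory.klDiv ρ κ = ∞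
  · simp [htop]
  obtain ⟨hac, hint⟩ := InformationTheory.klDiv_ne_top_iff.1 htop
  rw [InformationTheory.klDiv_of_ac_of_integrable hac hint]
  simp only [probReal_univ, add_sub_cancel_right]
  apply ENNReal.ofReal_le_ofReal
  -- `exp (-llr ρ κ)` is the density of the part of `κ` absolutely continuous with respect to `ρ`; a
  -- singular part of `κ` only helps, so an inequality suffices.
  have hlin : ∫⁻ a, ENNReal.ofReal (Real.exp (φ a - llr ρ κ a)) ∂ρ ≤ 1 := by
    calc ∫⁻ a, ENNReal.ofReal (Real.exp (φ a - llr ρ κ a)) ∂ρ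
        ≤ ∫⁻ a, κ.rnDeriv ρ a * ENNReal.ofReal (Real.exp (φ a)) ∂ρ := by
          apply lintegral_mono_ae
          filter_upwards [exp_neg_llr hac] with a ha
          rw [sub_eq_add_neg, Real.exp_add, ha, ENNReal.ofReal_mul (Real.exp_pos _).le, mul_comm]
          gcongr
          exact ENNReal.ofReal_toReal_le
      _ = ∫⁻ a, ENNReal.ofReal (Real.exp (φ a)) ∂(ρ.withDensity (κ.rnDeriv ρ)) := by
          rw [lintegral_withDensity_eq_lintegral_mul _ (Measure.measurable_rnDeriv _ _)
            (by fun_prop)]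
          rfl
      _ ≤ ∫⁻ a, ENNReal.ofReal (Real.exp (φ a)) ∂κ :=
          lintegral_mono' (Measure.withDensity_rnDeriv_le _ _) le_rfl
      _ ≤ 1 := hexp
  have hm : Measurable fun a => Real.exp (φ a - llr ρ κ a) := by
    have := measurable_llr ρ κ
    fun_prop
  have hi : Integrable (fun a => Real.exp (φ a - llr ρ κ a)) ρ := by
    refine ⟨hm.aestronglyMeasurable, ?_⟩
    rw [hasFiniteIntegral_iff_ofReal (ae_of_all _ fun a => (Real.exp_pos _).le)]
    exact hlin.trans_lt ENNReal.one_lt_top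
  have h1 : ∫ a, Real.exp (φ a - llr ρ κ a) ∂ρ ≤ 1 := by
    rw [integral_eq_lintegral_of_nonneg_ae (ae_of_all _ fun a => (Real.exp_pos _).le)
      hm.aestronglyMeasurable]
    exact ENNReal.toReal_mono ENNReal.one_ne_top hlin
  -- The pointwise bound `x ≤ exp x - 1` takes the place of Jensen's inequality.
  have h2 : ∫ a, (φ a - llr ρ κ a) ∂ρ ≤ ∫ a, (Real.exp (φ a - llr ρ κ a) - 1) ∂ρ := by
    apply integral_mono (hφ.sub hint) (hi.sub (integrable_const _))
    intro a
    have := Real.add_one_le_exp (φ a - llr ρ κ a)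
    simp only [Pi.sub_apply]
    linarith
  rw [integral_sub hφ hint, integral_sub hi (integrable_const _)] at h2
  simp at h2
  linarith

/-! ### Differentiation of mixtures along curves in `L²` -/

/-- A family bounded in `L²` that tends to zero almost everywhere tends to zero weakly. Split `|f h|
≤ min |f h| (f² / ε) + ε h²`: the first term is dominated by `f² / ε`, and the second has integral
at most `ε K`. -/
theorem tendsto_integral_mul_of_bounded_sq {Ω ι : Type*} [MeasurableSpace Ω] {m : Measure Ω}
    {l : Filter ι} [l.IsCountablyGenerated] {f : Ω → ℝ} (hfm : AEStronglyMeasurable f m)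
    (hf : Integrable (fun x => f x ^ 2) m) {h : ι → Ω → ℝ}
    (hm : ∀ t, AEStronglyMeasurable (h t) m)
    (hlim : ∀ᵐ x ∂m, Tendsto (fun t => h t x) l (𝓝 0)) {K : ℝ}
    (hbd : ∀ᶠ t in l, Integrable (fun x => h t x ^ 2) m ∧ ∫ x, h t x ^ 2 ∂m ≤ K) :
    Tendsto (fun t => ∫ x, f x * h t x ∂m) l (𝓝 0) := by
  have key : ∀ ε : ℝ, 0 < ε →
      Tendsto (fun t => ∫ x, min |f x * h t x| (f x ^ 2 / ε) ∂m) l (𝓝 0) := by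
    intro ε hε
    have h0 : (0 : ℝ) = ∫ x, (0 : ℝ) ∂m := by simp
    rw [h0]
    apply tendsto_integral_filter_of_dominated_convergence (fun x => f x ^ 2 / ε)
    · refine Eventually.of_forall fun t => ?_
      have h1 : AEStronglyMeasurable (fun x => |f x * h t x|) m := (hfm.mul (hm t)).norm
      exact h1.inf (hf.div_const ε).aestronglyMeasurable
    · refine Eventually.of_forall fun t => ae_of_all _ fun x => ?_
      rw [Real.norm_of_nonneg (le_min (abs_nonneg _) (by positivity))]
      exact min_le_right _ _
    · exact hf.div_const ε
    · filter_upwards [hlim] with x hx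
      have h1 : Tendsto (fun t => |f x * h t x|) l (𝓝 0) := by
        simpa using (hx.const_mul (f x)).abs
      refine tendsto_of_tendsto_of_tendsto_of_le_of_le tendsto_const_nhds h1 ?_ ?_
      · exact fun t => le_min (abs_nonneg _) (by positivity)
      · exact fun t => min_le_left _ _
  rw [Metric.tendsto_nhds]
  intro δ hδ
  set ε : ℝ := δ / (2 * (|K| + 1)) with hε
  have hεpos : 0 < ε := by positivity
  have hεK : ε * |K| < δ / 2 := by
    rw [hε, div_mul_eq_mul_div, div_lt_div_iff₀ (by positivity) two_pos]
    nlinarith [abs_nonneg K]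
  filter_upwards [hbd, (Metric.tendsto_nhds.1 (key ε hεpos)) (δ / 2) (by positivity)] with t ht1 ht2
  rw [Real.dist_eq, sub_zero] at ht2 ⊢
  have hmin : Integrable (fun x => min |f x * h t x| (f x ^ 2 / ε)) m := by
    refine (hf.div_const ε).mono' ?_ (ae_of_all _ fun x => ?_)
    · have h1 : AEStronglyMeasurable (fun x => |f x * h t x|) m := (hfm.mul (hm t)).norm
      exact h1.inf (hf.div_const ε).aestronglyMeasurable
    · rw [Real.norm_of_nonneg (le_min (abs_nonneg _) (by positivity))]
      exact min_le_right _ _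
  calc |∫ x, f x * h t x ∂m| ≤ ∫ x, |f x * h t x| ∂m := abs_integral_le_integral_abs
    _ ≤ ∫ x, (min |f x * h t x| (f x ^ 2 / ε) + ε * h t x ^ 2) ∂m := by
        apply integral_mono_of_nonneg (ae_of_all _ fun x => abs_nonneg _)
          (hmin.add (ht1.1.const_mul ε))
        refine ae_of_all _ fun x => ?_
        simp only [Pi.add_apply]
        rcases le_total |f x * h t x| (f x ^ 2 / ε) with hle | hle
        · rw [min_eq_left hle]
          have : 0 ≤ ε * h t x ^ 2 := by positivity
          linarith
        -- Here `f² / ε ≤ |f h|` forces `|f| ≤ ε |h|`, so `|f h| ≤ ε h²`.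
        · rw [min_eq_right hle]
          rw [div_le_iff₀ hεpos, abs_mul] at hle
          have h1 : |f x| ≤ |h t x| * ε := by
            rcases (abs_nonneg (f x)).eq_or_lt with h0 | h0
            · rw [← h0]; positivity
            · rw [← sq_abs] at hle
              by_contra hcon
              nlinarith
          rw [abs_mul]
          have : 0 ≤ f x ^ 2 / ε := by positivity
          have h2 : |f x| * |h t x| ≤ ε * h t x ^ 2 := by
            rw [← sq_abs (h t x)]
            nlinarith [abs_nonneg (h t x)]
          linarith
    _ = ∫ x, min |f x * h t x| (f x ^ 2 / ε) ∂m + ε * ∫ x, h t x ^ 2 ∂m := by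
        rw [integral_add hmin (ht1.1.const_mul ε), integral_const_mul]
    _ ≤ |∫ x, min |f x * h t x| (f x ^ 2 / ε) ∂m| + ε * |K| := by
        gcongr
        · exact le_abs_self _
        · exact ht1.2.trans (le_abs_self _)
    _ < δ := by linarith

/-- Cauchy–Schwarz, in the form that the variance of `deriv f` around its mean on `[a, b]` is
nonnegative. -/
theorem sq_sub_le_mul_integral_deriv_sq {f : ℝ → ℝ} (hf : ContDiff ℝ 1 f) {a b : ℝ} (hab : a ≤ b) :
    (f b - f a) ^ 2 ≤ (b - a) * ∫ s in a..b, deriv f s ^ 2 := by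
  have hc : Continuous (deriv f) := hf.continuous_deriv_one
  have hd : ∫ s in a..b, deriv f s = f b - f a :=
    intervalIntegral.integral_deriv_eq_sub (fun x _ => (hf.differentiable one_ne_zero) x)
      (hc.intervalIntegrable _ _)
  rcases hab.eq_or_lt with rfl | hlt
  · simp
  have hpos : 0 < b - a := sub_pos.2 hlt
  set M := (f b - f a) / (b - a) with hM
  have h0 : 0 ≤ ∫ s in a..b, (deriv f s - M) ^ 2 :=
    intervalIntegral.integral_nonneg hab fun s _ => sq_nonneg _
  have h1 : ∫ s in a..b, (deriv f s - M) ^ 2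
      = (∫ s in a..b, deriv f s ^ 2) - 2 * M * (f b - f a) + (b - a) * M ^ 2 := by
    have : ∀ s, (deriv f s - M) ^ 2 = deriv f s ^ 2 - 2 * M * deriv f s + M ^ 2 := fun s => by ring
    simp_rw [this]
    rw [intervalIntegral.integral_add, intervalIntegral.integral_sub,
      intervalIntegral.integral_const_mul, hd]
    · simp
    all_goals exact Continuous.intervalIntegrable (by fun_prop) _ _
  have h2 : M * (b - a) = f b - f a := by rw [hM]; field_simp
  rw [h1] at h0
  have h3 := mul_nonneg hpos.le h0
  have h4 : (b - a) * ((∫ s in a..b, deriv f s ^ 2) - 2 * M * (f b - f a) + (b - a) * M ^ 2)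
    = (b - a) * (∫ s in a..b, deriv f s ^ 2) - (f b - f a) ^ 2 := by
    rw [← h2]; ring
  linarith

theorem ofReal_sq_sub_le_lintegral_deriv_sq {f : ℝ → ℝ} (hf : ContDiff ℝ 1 f) (t : ℝ) :
    ENNReal.ofReal ((f t - f 0) ^ 2) ≤
      ENNReal.ofReal |t| * ∫⁻ s in Set.Icc (-|t|) |t|, ENNReal.ofReal (deriv f s ^ 2) := by
  have hc : Continuous (deriv f) := hf.continuous_deriv_one
  have key : ∀ a b : ℝ, a ≤ b → Set.Ioc a b ⊆ Set.Icc (-|t|) |t| → b - a = |t| →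
      ENNReal.ofReal ((f b - f a) ^ 2) ≤
      ENNReal.ofReal |t| * ∫⁻ s in Set.Icc (-|t|) |t|, ENNReal.ofReal (deriv f s ^ 2) := by
    intro a b hab hsub hba
    have h1 := sq_sub_le_mul_integral_deriv_sq hf hab
    rw [intervalIntegral.integral_of_le hab, hba] at h1
    refine (ENNReal.ofReal_le_ofReal h1).trans ?_
    rw [ENNReal.ofReal_mul (abs_nonneg _), ofReal_integral_eq_lintegral_ofReal]
    · gcongr
    · exact (Continuous.integrableOn_Icc (by fun_prop)).mono_set Set.Ioc_subset_Icc_self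
    · exact ae_of_all _ fun s => sq_nonneg _
  rcases le_total 0 t with h | h
  · refine key 0 t h ?_ (by rw [abs_of_nonneg h, sub_zero])
    rw [abs_of_nonneg h]
    exact fun s hs => ⟨by linarith [hs.1], hs.2⟩
  · have := key t 0 h ?_ (by rw [abs_of_nonpos h, zero_sub])
    · rwa [← neg_sq, neg_sub] at this
    · rw [abs_of_nonpos h]
      exact fun s hs => ⟨by linarith [hs.1], by linarith [hs.2]⟩

theorem measurable_deriv_of_contDiff {Ω : Type*} [MeasurableSpace Ω] {U : ℝ → Ω → ℝ}
    (hUm : ∀ t, Measurable (U t)) (hUc : ∀ x, ContDiff ℝ 1 fun t => U t x) (s : ℝ) :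
    Measurable fun x => deriv (fun t => U t x) s := by
  have hseq : Tendsto (fun k : ℕ => ((k : ℝ) + 1)⁻¹) atTop (𝓝[≠] 0) := by
    rw [tendsto_nhdsWithin_iff]
    refine ⟨by simpa using tendsto_one_div_add_atTop_nhds_zero_nat (𝕜 := ℝ), ?_⟩
    exact Eventually.of_forall fun k => by
      have : (0 : ℝ) < ((k : ℝ) + 1)⁻¹ := by positivity
      exact this.ne'
  refine measurable_of_tendsto_metrizable (f := fun (k : ℕ) x =>
    ((k : ℝ) + 1)⁻¹⁻¹ • (U (s + ((k : ℝ) + 1)⁻¹) x - U s x)) (fun k => ?_) ?_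
  · simp only [smul_eq_mul]
    exact ((hUm (s + ((k : ℝ) + 1)⁻¹)).sub (hUm s)).const_mul _
  · rw [tendsto_pi_nhds]
    intro x
    have hd : HasDerivAt (fun t => U t x) (deriv (fun t => U t x) s) s :=
      ((hUc x).differentiable one_ne_zero s).hasDerivAt
    exact (hasDerivAt_iff_tendsto_slope_zero.1 hd).comp hseq

theorem measurable_uncurry_deriv_of_contDiff {Ω : Type*} [MeasurableSpace Ω] {U : ℝ → Ω → ℝ}
    (hUm : ∀ t, Measurable (U t)) (hUc : ∀ x, ContDiff ℝ 1 fun t => U t x) :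
    Measurable (Function.uncurry fun s x => deriv (fun t => U t x) s) :=
  measurable_uncurry_of_continuous_of_measurable (fun x => (hUc x).continuous_deriv_one)
    (measurable_deriv_of_contDiff hUm hUc)

/-- The pointwise Cauchy–Schwarz bound followed by Tonelli. The weight `g` is used twice: `g = 1`
bounds increments in `L²`, and `g = c · y` bounds the quadratic remainder at a fixed observation. -/
theorem lintegral_sq_sub_le {Ω : Type*} [MeasurableSpace Ω] {m : Measure Ω} [SigmaFinite m]
    {U : ℝ → Ω → ℝ} (hUm : ∀ t, Measurable (U t)) (hUc : ∀ x, ContDiff ℝ 1 fun t => U t x)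
    {g : Ω → ℝ≥0∞} (hg : Measurable g) (t : ℝ) :
    ∫⁻ x, g x * ENNReal.ofReal ((U t x - U 0 x) ^ 2) ∂m ≤
      ENNReal.ofReal |t| * ∫⁻ s in Set.Icc (-|t|) |t|,
        ∫⁻ x, g x * ENNReal.ofReal (deriv (fun t => U t x) s ^ 2) ∂m := by
  have hV := measurable_uncurry_deriv_of_contDiff hUm hUc
  have hV2 : Measurable fun z : ℝ × Ω => ENNReal.ofReal (deriv (fun t => U t z.2) z.1 ^ 2) :=
    (hV.pow_const 2).ennreal_ofReal
  have hm : Measurable fun z : ℝ × Ω =>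
      g z.2 * ENNReal.ofReal (deriv (fun t => U t z.2) z.1 ^ 2) :=
    (hg.comp measurable_snd).mul hV2
  have hms : Measurable fun z : Ω × ℝ =>
      g z.1 * ENNReal.ofReal (deriv (fun t => U t z.1) z.2 ^ 2) := hm.comp measurable_swap
  calc ∫⁻ x, g x * ENNReal.ofReal ((U t x - U 0 x) ^ 2) ∂m
      ≤ ∫⁻ x, (ENNReal.ofReal |t| * ∫⁻ s in Set.Icc (-|t|) |t|,
          g x * ENNReal.ofReal (deriv (fun t => U t x) s ^ 2)) ∂m := by
        refine lintegral_mono fun x => ?_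
        have hx : Measurable fun s : ℝ => ENNReal.ofReal (deriv (fun t => U t x) s ^ 2) :=
          hV2.comp (measurable_id.prodMk measurable_const)
        rw [lintegral_const_mul _ hx, mul_left_comm]
        gcongr
        exact ofReal_sq_sub_le_lintegral_deriv_sq (hUc x) t
    _ = ENNReal.ofReal |t| * ∫⁻ x, (∫⁻ s in Set.Icc (-|t|) |t|,
          g x * ENNReal.ofReal (deriv (fun t => U t x) s ^ 2)) ∂m :=
        lintegral_const_mul _ hms.lintegral_prod_right'
    _ = _ := by
        rw [lintegral_lintegral_swap hms.aemeasurable]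

theorem integrable_of_lintegral_ofReal_le {Ω : Type*} [MeasurableSpace Ω] {m : Measure Ω}
    {f : Ω → ℝ} (hfm : AEStronglyMeasurable f m) (hf : ∀ x, 0 ≤ f x) {B : ℝ≥0∞} (hB : B ≠ ∞)
    (h : ∫⁻ x, ENNReal.ofReal (f x) ∂m ≤ B) : Integrable f m ∧ ∫ x, f x ∂m ≤ B.toReal := by
  refine ⟨⟨hfm, ?_⟩, ?_⟩
  · rw [hasFiniteIntegral_iff_ofReal (ae_of_all _ hf)]
    exact h.trans_lt hB.lt_top
  · rw [integral_eq_lintegral_of_nonneg_ae (ae_of_all _ hf) hfm]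
    exact ENNReal.toReal_mono hB h

/-- Differentiation under the integral sign for a mixture density: if `U` is a curve of
square-integrable functions with derivative bounded in `L²`, then for almost every `y` the function
`t ↦ ∫ c x y * U t x ^ 2` is differentiable at `0`. -/
theorem ae_hasDerivAt_integral_mul_sq {Ω Y : Type*} [MeasurableSpace Ω] [MeasurableSpace Y]
    {m : Measure Ω} [SigmaFinite m] {ν : Measure Y} [SigmaFinite ν] {U : ℝ → Ω → ℝ}
    (hUm : ∀ t, Measurable (U t)) (hUc : ∀ x, ContDiff ℝ 1 fun t => U t x)
    (hU0 : ∫⁻ x, ENNReal.ofReal (U 0 x ^ 2) ∂m ≠ ∞) {K : ℝ≥0}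
    (hK : ∀ s, ∫⁻ x, ENNReal.ofReal (deriv (fun t => U t x) s ^ 2) ∂m ≤ K)
    {c : Ω → Y → ℝ} (hc0 : ∀ x y, 0 ≤ c x y) (hcm : Measurable (Function.uncurry c))
    (hc1 : ∀ x, ∫⁻ y, ENNReal.ofReal (c x y) ∂ν = 1)
    (hc2 : ∀ᵐ y ∂ν, Integrable (fun x => c x y ^ 2 * U 0 x ^ 2) m) :
    ∀ᵐ y ∂ν, HasDerivAt (fun t => ∫ x, c x y * U t x ^ 2 ∂m)
      (2 * ∫ x, c x y * (U 0 x * deriv (fun t => U t x) 0) ∂m) 0 := by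
  have hV := measurable_uncurry_deriv_of_contDiff hUm hUc
  have hcy : ∀ y, Measurable fun x => c x y := fun y =>
    hcm.comp (measurable_id.prodMk measurable_const)
  have hV2 : Measurable fun z : ℝ × Ω => ENNReal.ofReal (deriv (fun t => U t z.2) z.1 ^ 2) :=
    (hV.pow_const 2).ennreal_ofReal
  have hVs : ∀ s, Measurable fun x => deriv (fun t => U t x) s :=
    measurable_deriv_of_contDiff hUm hUc
  -- `H y s` is the energy of the curve at time `s` weighted by the likelihood of `y`. Its integral
  -- over `y` is the unweighted energy, so `H y` is integrable on `[-1, 1]` for almost every `y`.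
  set H : Y → ℝ → ℝ≥0∞ := fun y s =>
    ∫⁻ x, ENNReal.ofReal (c x y) * ENNReal.ofReal (deriv (fun t => U t x) s ^ 2) ∂m with hH
  have hHm' : Measurable fun z : (Y × ℝ) × Ω => ENNReal.ofReal (c z.2 z.1.1) *
      ENNReal.ofReal (deriv (fun t => U t z.2) z.1.2 ^ 2) := by
    have h1 : Measurable fun z : (Y × ℝ) × Ω => ENNReal.ofReal (c z.2 z.1.1) :=
      (hcm.comp (measurable_snd.prodMk measurable_fst.fst)).ennreal_ofReal
    have h2 : Measurable fun z : (Y × ℝ) × Ω =>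
        ENNReal.ofReal (deriv (fun t => U t z.2) z.1.2 ^ 2) :=
      hV2.comp (measurable_fst.snd.prodMk measurable_snd)
    exact h1.mul h2
  have hHm : Measurable (Function.uncurry H) := hHm'.lintegral_prod_right'
  have hswap : ∀ g : Ω → ℝ≥0∞, Measurable g →
      ∫⁻ y, ∫⁻ x, ENNReal.ofReal (c x y) * g x ∂m ∂ν = ∫⁻ x, g x ∂m := by
    intro g hg
    rw [lintegral_lintegral_swap]
    · refine lintegral_congr fun x => ?_
      rw [lintegral_mul_const, hc1, one_mul]
      exact (hcm.comp (measurable_const.prodMk measurable_id)).ennreal_ofReal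
    · exact ((hcm.comp measurable_swap).ennreal_ofReal.mul (hg.comp measurable_snd)).aemeasurable
  have hHfin : ∀ᵐ y ∂ν, ∫⁻ s in Set.Icc (-1 : ℝ) 1, H y s < ∞ := by
    refine ae_lt_top hHm.lintegral_prod_right' (ne_of_lt ?_)
    rw [lintegral_lintegral_swap hHm.aemeasurable]
    calc ∫⁻ s in Set.Icc (-1 : ℝ) 1, ∫⁻ y, H y s ∂ν
        = ∫⁻ s in Set.Icc (-1 : ℝ) 1, ∫⁻ x, ENNReal.ofReal (deriv (fun t => U t x) s ^ 2) ∂m := by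
          refine lintegral_congr fun s => ?_
          exact hswap _ ((hVs s).pow_const 2).ennreal_ofReal
      _ ≤ ∫⁻ s in Set.Icc (-1 : ℝ) 1, K := lintegral_mono fun s => hK s
      _ < ∞ := by
          rw [setLIntegral_const, Real.volume_Icc]
          exact ENNReal.mul_lt_top ENNReal.coe_lt_top ENNReal.ofReal_lt_top
  have hc0fin : ∀ᵐ y ∂ν, ∫⁻ x, ENNReal.ofReal (c x y) * ENNReal.ofReal (U 0 x ^ 2) ∂m < ∞ := by
    refine ae_lt_top ?_ ?_
    · exact Measurable.lintegral_prod_right' (f := fun z : Y × Ω =>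
        ENNReal.ofReal (c z.2 z.1) * ENNReal.ofReal (U 0 z.2 ^ 2))
        ((hcm.comp measurable_swap).ennreal_ofReal.mul
          (((hUm 0).pow_const 2).ennreal_ofReal.comp measurable_snd))
    · rwa [hswap _ ((hUm 0).pow_const 2).ennreal_ofReal]
  -- the increments of `U` are `O(t)` in `L²`
  have hinc : ∀ t, Integrable (fun x => (U t x - U 0 x) ^ 2) m ∧
      ∫ x, (U t x - U 0 x) ^ 2 ∂m ≤ 2 * K * t ^ 2 := by
    intro t
    have h1 := lintegral_sq_sub_le (m := m) hUm hUc (g := 1) measurable_one t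
    simp only [Pi.one_apply, one_mul] at h1
    have h2 : ∫⁻ s in Set.Icc (-|t|) |t|,
        ∫⁻ x, ENNReal.ofReal (deriv (fun t => U t x) s ^ 2) ∂m ≤ K * ENNReal.ofReal (2 * |t|) := by
      refine (lintegral_mono fun s => hK s).trans ?_
      rw [setLIntegral_const, Real.volume_Icc]
      gcongr
      linarith
    have h3 := h1.trans (mul_le_mul_right h2 _)
    have h4 := integrable_of_lintegral_ofReal_le
      (((hUm t).sub (hUm 0)).pow_const 2).aestronglyMeasurable (fun x => sq_nonneg _)
      (ENNReal.mul_ne_top ENNReal.ofReal_ne_top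
        (ENNReal.mul_ne_top ENNReal.coe_ne_top ENNReal.ofReal_ne_top)) h3
    refine ⟨h4.1, h4.2.trans (le_of_eq ?_)⟩
    rw [ENNReal.toReal_mul, ENNReal.toReal_mul, ENNReal.toReal_ofReal (abs_nonneg _),
      ENNReal.toReal_ofReal (by positivity), ENNReal.coe_toReal, ← sq_abs]
    ring
  have hVint : Integrable (fun x => deriv (fun t => U t x) 0 ^ 2) m :=
    (integrable_of_lintegral_ofReal_le ((hVs 0).pow_const 2).aestronglyMeasurable
      (fun x => sq_nonneg _) ENNReal.coe_ne_top (hK 0)).1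
  filter_upwards [hc2, hHfin, hc0fin] with y hy2 hyH hy0
  have hcU : Integrable (fun x => (c x y * U 0 x) ^ 2) m := by simpa [mul_pow] using hy2
  have hcUm : AEStronglyMeasurable (fun x => c x y * U 0 x) m :=
    ((hcy y).mul (hUm 0)).aestronglyMeasurable
  have hcUL2 : MemLp (fun x => c x y * U 0 x) 2 m := (memLp_two_iff_integrable_sq hcUm).2 hcU
  have hincL2 : ∀ t, MemLp (fun x => U t x - U 0 x) 2 m := fun t =>
    (memLp_two_iff_integrable_sq ((hUm t).sub (hUm 0)).aestronglyMeasurable).2 (hinc t).1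
  have hVL2 : MemLp (fun x => deriv (fun t => U t x) 0) 2 m :=
    (memLp_two_iff_integrable_sq (hVs 0).aestronglyMeasurable).2 hVint
  have hF0 : Integrable (fun x => c x y * U 0 x ^ 2) m := by
    refine (integrable_of_lintegral_ofReal_le (f := fun x => c x y * U 0 x ^ 2)
      ((hcy y).mul ((hUm 0).pow_const 2)).aestronglyMeasurable
      (fun x => mul_nonneg (hc0 x y) (sq_nonneg _)) hy0.ne (le_of_eq ?_)).1
    simp_rw [ENNReal.ofReal_mul (hc0 _ _)]
  -- the quadratic remainder
  have hrem : ∀ t, |t| ≤ 1 → Integrable (fun x => c x y * (U t x - U 0 x) ^ 2) m ∧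
      ∫ x, c x y * (U t x - U 0 x) ^ 2 ∂m ≤
        |t| * (∫⁻ s in Set.Icc (-|t|) |t|, H y s).toReal := by
    intro t ht
    have h1 := lintegral_sq_sub_le (m := m) hUm hUc (hcy y).ennreal_ofReal t
    have hle : ∫⁻ s in Set.Icc (-|t|) |t|, H y s ≤ ∫⁻ s in Set.Icc (-1 : ℝ) 1, H y s :=
      lintegral_mono_set (Set.Icc_subset_Icc (by linarith) ht)
    have h2 := integrable_of_lintegral_ofReal_le (m := m)
      (f := fun x => c x y * (U t x - U 0 x) ^ 2)
      (((hcy y).mul (((hUm t).sub (hUm 0)).pow_const 2)).aestronglyMeasurable)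
      (fun x => mul_nonneg (hc0 x y) (sq_nonneg _))
      (ENNReal.mul_ne_top (ENNReal.ofReal_ne_top (r := |t|)) (hle.trans_lt hyH).ne)
      (by simp_rw [ENNReal.ofReal_mul (hc0 _ _)]; exact h1)
    refine ⟨h2.1, h2.2.trans (le_of_eq ?_)⟩
    rw [ENNReal.toReal_mul, ENNReal.toReal_ofReal (abs_nonneg _)]
  have hexpand : ∀ t, |t| ≤ 1 → ∫ x, c x y * U t x ^ 2 ∂m = ∫ x, c x y * U 0 x ^ 2 ∂m +
      2 * ∫ x, (c x y * U 0 x) * (U t x - U 0 x) ∂m + ∫ x, c x y * (U t x - U 0 x) ^ 2 ∂m := by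
    intro t ht
    have hcross : Integrable (fun x => (c x y * U 0 x) * (U t x - U 0 x)) m :=
      hcUL2.integrable_mul (hincL2 t)
    rw [← integral_const_mul, ← integral_add hF0 (hcross.const_mul 2), ← integral_add _ (hrem t ht).1]
    · refine integral_congr_ae (ae_of_all _ fun x => ?_)
      ring
    · exact hF0.add (hcross.const_mul 2)
  rw [hasDerivAt_iff_tendsto_slope_zero]
  have hlin : Tendsto (fun t : ℝ => ∫ x, (c x y * U 0 x) *
      (t⁻¹ * (U t x - U 0 x) - deriv (fun t => U t x) 0) ∂m) (𝓝[≠] 0) (𝓝 0) := by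
    -- By `(a - b)² ≤ 2a² + 2b²`, the quotient contributes `2 t⁻² · 2K t² = 4K` and the derivative
    -- contributes `2K`.
    refine tendsto_integral_mul_of_bounded_sq (K := 4 * K + 2 * K) hcUm hcU (fun t => ?_) ?_ ?_
    · exact ((((hUm t).sub (hUm 0)).const_mul _).sub (hVs 0)).aestronglyMeasurable
    · refine ae_of_all _ fun x => ?_
      have hd : HasDerivAt (fun t => U t x) (deriv (fun t => U t x) 0) 0 :=
        ((hUc x).differentiable one_ne_zero 0).hasDerivAt
      have := hasDerivAt_iff_tendsto_slope_zero.1 hd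
      simp only [zero_add, smul_eq_mul] at this
      simpa using this.sub_const (deriv (fun t => U t x) 0)
    · filter_upwards [self_mem_nhdsWithin] with t (ht : t ≠ 0)
      refine ⟨(((hincL2 t).const_mul _).sub hVL2).integrable_sq, ?_⟩
      have h1 : ∫ x, (t⁻¹ * (U t x - U 0 x) - deriv (fun t => U t x) 0) ^ 2 ∂m ≤
          ∫ x, (2 * t⁻¹ ^ 2 * (U t x - U 0 x) ^ 2 + 2 * deriv (fun t => U t x) 0 ^ 2) ∂m := by
        refine integral_mono (((hincL2 t).const_mul _).sub hVL2).integrable_sq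
          (((hinc t).1.const_mul _).add (hVint.const_mul 2)) fun x => ?_
        simp only
        nlinarith [sq_nonneg (t⁻¹ * (U t x - U 0 x) + deriv (fun t => U t x) 0)]
      rw [integral_add ((hinc t).1.const_mul _) (hVint.const_mul 2), integral_const_mul,
        integral_const_mul] at h1
      have h2 : 2 * t⁻¹ ^ 2 * ∫ x, (U t x - U 0 x) ^ 2 ∂m ≤ 4 * (K : ℝ) := by
        calc 2 * t⁻¹ ^ 2 * ∫ x, (U t x - U 0 x) ^ 2 ∂m ≤ 2 * t⁻¹ ^ 2 * (2 * K * t ^ 2) := by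
              gcongr
              exact (hinc t).2
          _ = 4 * (K : ℝ) := by field_simp; ring
      have h3 : ∫ x, deriv (fun t => U t x) 0 ^ 2 ∂m ≤ (K : ℝ) := by
        have := (integrable_of_lintegral_ofReal_le ((hVs 0).pow_const 2).aestronglyMeasurable
          (fun x => sq_nonneg _) ENNReal.coe_ne_top (hK 0)).2
        simpa using this
      linarith
  have hle1 : ∀ᶠ t : ℝ in 𝓝[≠] 0, |t| ≤ 1 := by
    refine nhdsWithin_le_nhds ?_
    filter_upwards [Metric.closedBall_mem_nhds (0 : ℝ) one_pos] with t ht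
    simpa [Real.dist_eq] using ht
  have hquad : Tendsto (fun t : ℝ => t⁻¹ * ∫ x, c x y * (U t x - U 0 x) ^ 2 ∂m)
      (𝓝[≠] 0) (𝓝 0) := by
    -- Absolute continuity of the integral of `H y` upgrades the remainder from `O(t)` to `o(t)`.
    have hlim : Tendsto (fun t : ℝ => (∫⁻ s in Set.Icc (-|t|) |t|, H y s).toReal)
        (𝓝[≠] 0) (𝓝 0) := by
      have h1 : Tendsto (fun t : ℝ => ∫⁻ s in Set.Icc (-|t|) |t|, H y s
          ∂(volume.restrict (Set.Icc (-1 : ℝ) 1))) (𝓝[≠] 0) (𝓝 0) := by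
        refine tendsto_setLIntegral_zero hyH.ne ?_
        have h2 : Tendsto (fun t : ℝ => ENNReal.ofReal (|t| - -|t|)) (𝓝[≠] 0) (𝓝 0) := by
          have : Continuous fun t : ℝ => ENNReal.ofReal (|t| - -|t|) :=
            ENNReal.continuous_ofReal.comp (by fun_prop)
          simpa using (this.tendsto 0).mono_left nhdsWithin_le_nhds
        refine tendsto_of_tendsto_of_tendsto_of_le_of_le tendsto_const_nhds h2
          (fun _ => zero_le) fun t => ?_
        refine (Measure.restrict_apply_le _ _).trans (le_of_eq ?_)
        exact Real.volume_Icc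
      have h3 := (ENNReal.tendsto_toReal ENNReal.zero_ne_top).comp h1
      refine h3.congr' ?_
      filter_upwards [hle1] with t ht
      rw [Function.comp_apply, Measure.restrict_restrict measurableSet_Icc,
        Set.inter_eq_left.2 (Set.Icc_subset_Icc (by linarith) ht)]
    refine squeeze_zero_norm' ?_ hlim
    filter_upwards [hle1, self_mem_nhdsWithin] with t ht (ht0 : t ≠ 0)
    rw [norm_mul, norm_inv, Real.norm_eq_abs, Real.norm_of_nonneg
      (integral_nonneg fun x => mul_nonneg (hc0 x y) (sq_nonneg _)),
      inv_mul_le_iff₀ (abs_pos.2 ht0)]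
    exact (hrem t ht).2
  have hsum := ((hlin.const_mul 2).add hquad).add_const
    (2 * ∫ x, c x y * (U 0 x * deriv (fun t => U t x) 0) ∂m)
  simp only [mul_zero, add_zero, zero_add] at hsum
  refine hsum.congr' ?_
  filter_upwards [hle1] with t ht
  have hi1 : Integrable (fun x => (c x y * U 0 x) * (t⁻¹ * (U t x - U 0 x))) m :=
    hcUL2.integrable_mul ((hincL2 t).const_mul _)
  have hi2 : Integrable (fun x => (c x y * U 0 x) * deriv (fun t => U t x) 0) m :=
    hcUL2.integrable_mul hVL2
  rw [zero_add, hexpand t ht, smul_eq_mul]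
  simp_rw [mul_sub (c _ y * U 0 _) (t⁻¹ * _)]
  rw [integral_sub hi1 hi2]
  have e1 : ∫ x, (c x y * U 0 x) * (t⁻¹ * (U t x - U 0 x)) ∂m =
      t⁻¹ * ∫ x, (c x y * U 0 x) * (U t x - U 0 x) ∂m := by
    rw [← integral_const_mul]
    exact integral_congr_ae (ae_of_all _ fun x => by simp only; ring)
  have e2 : ∫ x, c x y * (U 0 x * deriv (fun t => U t x) 0) ∂m =
      ∫ x, (c x y * U 0 x) * deriv (fun t => U t x) 0 ∂m := by
    simp_rw [mul_assoc]
  rw [e1, e2]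
  ring

/-! ### Product measures and sequential densities -/

theorem lintegral_fintype_prod_eq_prod {ι : Type*} [Fintype ι] {X : ι → Type*}
    [∀ i, MeasurableSpace (X i)] (μ : ∀ i, Measure (X i)) [∀ i, SigmaFinite (μ i)]
    {f : ∀ i, X i → ℝ≥0∞} (hf : ∀ i, Measurable (f i)) :
    ∫⁻ x, ∏ i, f i (x i) ∂(Measure.pi μ) = ∏ i, ∫⁻ x, f i x ∂(μ i) := by
  classical
  rcases isEmpty_or_nonempty (∀ i, X i) with hX | ⟨⟨x₀⟩⟩
  · obtain ⟨i, hi⟩ : ∃ i, IsEmpty (X i) := by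
      by_contra! h
      exact hX.false fun i => Classical.choice (h i)
    rw [Finset.prod_eq_zero (Finset.mem_univ i)]
    · rw [lintegral_of_isEmpty]
    · rw [lintegral_of_isEmpty]
  have key : ∀ (s : Finset ι) (x : ∀ i, X i),
      (∫⋯∫⁻_s, (fun x => ∏ i ∈ s, f i (x i)) ∂μ) x = ∏ i ∈ s, ∫⁻ x, f i x ∂(μ i) := by
    intro s
    induction s using Finset.induction with
    | empty => simp
    | insert a s ha ih =>
      intro x
      have hm : Measurable fun x : ∀ i, X i => ∏ i ∈ insert a s, f i (x i) :=
        Finset.measurable_fun_prod _ fun i _ => (hf i).comp (measurable_pi_apply i)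
      rw [lmarginal_insert _ hm ha, Finset.prod_insert ha, ← lintegral_mul_const _ (hf a)]
      refine lintegral_congr fun z => ?_
      rw [← ih (Function.update x a z)]
      simp only [lmarginal]
      rw [← lintegral_const_mul]
      · refine lintegral_congr fun w => ?_
        rw [Finset.prod_insert ha]
        congr 2
        simp [Function.updateFinset, ha]
      · exact (Finset.measurable_fun_prod _ fun i _ =>
          (hf i).comp (measurable_pi_apply i)).comp measurable_updateFinset
  simpa using key Finset.univ x₀

theorem pi_withDensity {ι : Type*} [Fintype ι] {X : ι → Type*}
    [∀ i, MeasurableSpace (X i)] (μ : ∀ i, Measure (X i)) [∀ i, SigmaFinite (μ i)]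
    {f : ∀ i, X i → ℝ≥0∞} (hf : ∀ i, Measurable (f i))
    [∀ i, SigmaFinite ((μ i).withDensity (f i))] :
    Measure.pi (fun i => (μ i).withDensity (f i)) =
      (Measure.pi μ).withDensity fun x => ∏ i, f i (x i) := by
  refine Measure.pi_eq fun s hs => ?_
  rw [withDensity_apply _ (MeasurableSet.univ_pi hs), ← lintegral_indicator (MeasurableSet.univ_pi hs)]
  have : ∀ x : ∀ i, X i, (Set.univ.pi s).indicator (fun x => ∏ i, f i (x i)) x =
      ∏ i, (s i).indicator (f i) (x i) := by
    intro x
    by_cases hx : x ∈ Set.univ.pi s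
    · rw [Set.indicator_of_mem hx]
      exact Finset.prod_congr rfl fun i _ => by
        rw [Set.indicator_of_mem (hx i (Set.mem_univ i))]
    · rw [Set.indicator_of_notMem hx]
      simp only [Set.mem_univ_pi, not_forall] at hx
      obtain ⟨i, hi⟩ := hx
      exact (Finset.prod_eq_zero (Finset.mem_univ i) (Set.indicator_of_notMem hi _)).symm
  simp_rw [this]
  rw [lintegral_fintype_prod_eq_prod μ fun i => (hf i).indicator (hs i)]
  refine Finset.prod_congr rfl fun i _ => ?_
  rw [lintegral_indicator (hs i), withDensity_apply _ (hs i)]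

/-- A product of conditional densities, each one given the preceding coordinates, has total
mass one. -/
theorem lintegral_prod_cond_density {ι : Type*} [Fintype ι] [LinearOrder ι] {Y : ι → Type*}
    [∀ i, MeasurableSpace (Y i)] (ν : ∀ i, Measure (Y i)) [∀ i, SigmaFinite (ν i)]
    (g : ∀ i, (∀ r : {r // r < i}, Y r) → Y i → ℝ≥0∞)
    (hg : ∀ i, Measurable fun y : ∀ i, Y i => g i (fun r => y r) (y i))
    (hg1 : ∀ i h, ∫⁻ y, g i h y ∂(ν i) = 1) [Nonempty (∀ i, Y i)] :
    ∫⁻ y, ∏ i, g i (fun r => y r) (y i) ∂(Measure.pi ν) = 1 := by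
  have key : ∀ (s : Finset ι) (y : ∀ i, Y i),
      (∫⋯∫⁻_s, (fun y => ∏ i ∈ s, g i (fun r => y r) (y i)) ∂ν) y = 1 := by
    intro s
    -- Adding a new minimum `a` means that the later coordinates are integrated out first; the
    -- factor at `a` depends only on coordinates up to `a`, none of which other than `a` is
    -- affected.
    induction s using Finset.induction_on_min with
    | empty => simp
    | insert a s has ih =>
      have ha : a ∉ s := fun h => lt_irrefl _ (has a h)
      intro y
      rw [lmarginal_insert _ (Finset.measurable_fun_prod _ fun i _ => hg i) ha,
        ← hg1 a (fun r : {r // r < a} => y r)]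
      refine lintegral_congr fun z => ?_
      rw [← mul_one (g a (fun r : {r // r < a} => y r) z), ← ih (Function.update y a z)]
      simp only [lmarginal]
      rw [← lintegral_const_mul]
      · refine lintegral_congr fun w => ?_
        rw [Finset.prod_insert ha]
        have e1 : Function.updateFinset (Function.update y a z) s w a = z := by
          simp [Function.updateFinset, ha]
        have e2 : (fun r : {r // r < a} =>
            Function.updateFinset (Function.update y a z) s w r) =
            fun r : {r // r < a} => y r := by
          funext r
          have h1 : (r : ι) ∉ s := fun h => lt_asymm r.2 (has _ h)
          simp [Function.updateFinset, h1, r.2.ne]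
        rw [e1, e2]
      · exact (Finset.measurable_fun_prod _ fun i _ => hg i).comp measurable_updateFinset
  obtain ⟨y₀⟩ := ‹Nonempty (∀ i, Y i)›
  simpa using key Finset.univ y₀

/-! ### Products of square-root densities along a curve -/

theorem measurable_prod_curve {𝒳 : Type*} [MeasurableSpace 𝒳] {n : ℕ} {u : ℝ → 𝒳 → ℝ} (hum : ∀ t, Measurable (u t)) (t : ℝ) :
    Measurable fun x : Fin n → 𝒳 => ∏ i, u t (x i) :=
  Finset.measurable_fun_prod _ fun i _ => (hum t).comp (measurable_pi_apply i)

theorem contDiff_prod_curve {𝒳 : Type*} {n : ℕ} {u : ℝ → 𝒳 → ℝ}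
    (huc : ∀ x, ContDiff ℝ 1 fun t => u t x) (x : Fin n → 𝒳) :
    ContDiff ℝ 1 fun t => ∏ i, u t (x i) :=
  contDiff_prod fun i _ => huc (x i)

theorem deriv_prod_curve {𝒳 : Type*} {n : ℕ} {u : ℝ → 𝒳 → ℝ}
    (huc : ∀ x, ContDiff ℝ 1 fun t => u t x) (x : Fin n → 𝒳) (s : ℝ) :
    deriv (fun t => ∏ i, u t (x i)) s =
      ∑ i, (∏ k ∈ Finset.univ.erase i, u s (x k)) * deriv (fun t => u t (x i)) s := by
  have := HasDerivAt.fun_finsetProd (u := Finset.univ) (x := s) (f := fun i t => u t (x i))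
    (f' := fun i => deriv (fun t => u t (x i)) s)
    fun i _ => ((huc (x i)).differentiable one_ne_zero s).hasDerivAt
  simpa using this.deriv

theorem lintegral_sq_prod_curve {𝒳 : Type*} [MeasurableSpace 𝒳] {μ : Measure 𝒳} [SigmaFinite μ]
    {n : ℕ} {u : ℝ → 𝒳 → ℝ} (hum : ∀ t, Measurable (u t)) (t : ℝ)
    (hu1 : ∫⁻ x, ENNReal.ofReal (u t x ^ 2) ∂μ = 1) :
    ∫⁻ x, ENNReal.ofReal ((∏ i, u t (x i)) ^ 2) ∂(Measure.pi fun _ : Fin n => μ) = 1 := by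
  have : ∀ x : Fin n → 𝒳, ENNReal.ofReal ((∏ i, u t (x i)) ^ 2) =
      ∏ i, ENNReal.ofReal (u t (x i) ^ 2) := fun x => by
    rw [← Finset.prod_pow, ENNReal.ofReal_prod_of_nonneg fun i _ => sq_nonneg _]
  simp_rw [this]
  rw [lintegral_fintype_prod_eq_prod _ fun i => ((hum t).pow_const 2).ennreal_ofReal]
  simp [hu1]

/-- The derivative is a sum of `n` terms, one per differentiated factor. Cauchy–Schwarz on the sum
costs a factor `n`, and each squared term integrates to at most `K` because the other factors have
unit mass. -/
theorem lintegral_sq_deriv_prod_curve_le {𝒳 : Type*} [MeasurableSpace 𝒳] {μ : Measure 𝒳} [SigmaFinite μ]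
    {n : ℕ} {u : ℝ → 𝒳 → ℝ} (hum : ∀ t, Measurable (u t))
    (huc : ∀ x, ContDiff ℝ 1 fun t => u t x) (s : ℝ)
    (hu1 : ∫⁻ x, ENNReal.ofReal (u s x ^ 2) ∂μ = 1) {K : ℝ≥0}
    (hK : ∫⁻ x, ENNReal.ofReal (deriv (fun t => u t x) s ^ 2) ∂μ ≤ K) :
    ∫⁻ x, ENNReal.ofReal (deriv (fun t => ∏ i, u t (x i)) s ^ 2)
      ∂(Measure.pi fun _ : Fin n => μ) ≤ (n * (n * K) : ℝ≥0) := by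
  have hd := measurable_deriv_of_contDiff hum huc s
  set f : Fin n → Fin n → 𝒳 → ℝ≥0∞ := fun i k z =>
    if k = i then ENNReal.ofReal (deriv (fun t => u t z) s ^ 2) else ENNReal.ofReal (u s z ^ 2)
    with hf
  have hfm : ∀ i k, Measurable (f i k) := by
    intro i k
    by_cases h : k = i
    · simp only [hf, h, if_true]
      exact (hd.pow_const 2).ennreal_ofReal
    · simp only [hf, h, if_false]
      exact ((hum s).pow_const 2).ennreal_ofReal
  have hle : ∀ x : Fin n → 𝒳, ENNReal.ofReal (deriv (fun t => ∏ i, u t (x i)) s ^ 2) ≤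
      n * ∑ i, ∏ k, f i k (x k) := by
    intro x
    rw [deriv_prod_curve huc]
    refine (ENNReal.ofReal_le_ofReal sq_sum_le_card_mul_sum_sq).trans (le_of_eq ?_)
    rw [ENNReal.ofReal_mul (by positivity), ENNReal.ofReal_sum_of_nonneg fun i _ => sq_nonneg _]
    simp only [Finset.card_univ, Fintype.card_fin, ENNReal.ofReal_natCast]
    congr 1
    refine Finset.sum_congr rfl fun i _ => ?_
    rw [← Finset.mul_prod_erase _ _ (Finset.mem_univ i), mul_pow, ← Finset.prod_pow,
      ENNReal.ofReal_mul (Finset.prod_nonneg fun _ _ => sq_nonneg _),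
      ENNReal.ofReal_prod_of_nonneg fun _ _ => sq_nonneg _, mul_comm]
    congr 1
    · simp [hf]
    · exact Finset.prod_congr rfl fun k hk => by simp [hf, Finset.ne_of_mem_erase hk]
  have hprodm : ∀ i, Measurable fun x : Fin n → 𝒳 => ∏ k, f i k (x k) := fun i =>
    Finset.measurable_fun_prod _ fun k _ => (hfm i k).comp (measurable_pi_apply k)
  refine (lintegral_mono hle).trans ?_
  rw [lintegral_const_mul _ (Finset.measurable_fun_sum _ fun i _ => hprodm i),
    lintegral_finsetSum _ fun i _ => hprodm i]
  push_cast
  gcongr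
  have : ∀ i ∈ (Finset.univ : Finset (Fin n)),
      ∫⁻ x, ∏ k, f i k (x k) ∂(Measure.pi fun _ : Fin n => μ) ≤ K := by
    intro i _
    rw [lintegral_fintype_prod_eq_prod _ (hfm i), ← Finset.mul_prod_erase _ _ (Finset.mem_univ i),
      Finset.prod_eq_one, mul_one]
    · simpa [hf] using hK
    · intro k hk
      simpa [hf, Finset.ne_of_mem_erase hk] using hu1
  simpa using Finset.sum_le_sum this

/-! ### The transcript channel -/

namespace BlackboardProtocol

variable {d n T : ℕ} {𝒳 : Type*} [MeasurableSpace 𝒳] {μ : Measure 𝒳}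
  {𝒴 : Fin T ×ₗ Fin n → Type*} [∀ s, MeasurableSpace (𝒴 s)] {ν : ∀ s, Measure (𝒴 s)}

theorem measurable_transcriptChan (C : BlackboardProtocol 𝒳 n T 𝒴 ν) :
    Measurable fun z : (Fin n → 𝒳) × (∀ s, 𝒴 s) => C.transcriptChan z.1 z.2 := by
  unfold transcriptChan
  refine Finset.measurable_fun_prod _ fun s _ => ?_
  have : Measurable fun z : (Fin n → 𝒳) × (∀ s, 𝒴 s) =>
      ((z.1 (ofLex s).2, (fun r : {r // r < s} => z.2 r), z.2 s) :
        𝒳 × (∀ r : {r : Fin T ×ₗ Fin n // r < s}, 𝒴 r) × 𝒴 s) := by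
    fun_prop
  exact (C.measurable_chan s).comp this

theorem transcriptChan_nonneg (C : BlackboardProtocol 𝒳 n T 𝒴 ν) (x : Fin n → 𝒳) (π : ∀ s, 𝒴 s) :
    0 ≤ C.transcriptChan x π :=
  Finset.prod_nonneg fun _ _ => C.nonneg_chan _ _ _ _

theorem lintegral_transcriptChan [∀ s, SigmaFinite (ν s)] (C : BlackboardProtocol 𝒳 n T 𝒴 ν)
    (x : Fin n → 𝒳) : ∫⁻ π, ENNReal.ofReal (C.transcriptChan x π) ∂(Measure.pi ν) = 1 := by
  -- An empty message space could not carry a density of mass one after an available history, so a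
  -- transcript can be built recursively.
  have hne : Nonempty (∀ s, 𝒴 s) := by
    have hstep : ∀ s, (∀ r, r < s → 𝒴 r) → Nonempty (𝒴 s) := by
      intro s ih
      by_contra hcon
      have : IsEmpty (𝒴 s) := not_nonempty_iff.1 hcon
      have h1 := C.lintegral_chan s (x (ofLex s).2) fun r => ih r r.2
      rw [lintegral_of_isEmpty] at h1
      exact zero_ne_one h1
    exact ⟨wellFounded_lt.fix fun s ih => Classical.choice (hstep s ih)⟩
  have := lintegral_prod_cond_density ν
    (fun s h y => ENNReal.ofReal (C.chan s (x (ofLex s).2) h y)) (fun s => ?_)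
    (fun s h => C.lintegral_chan s _ h)
  · rw [← this]
    refine lintegral_congr fun π => ?_
    rw [transcriptChan, ENNReal.ofReal_prod_of_nonneg fun _ _ => C.nonneg_chan _ _ _ _]
  · have hm : Measurable fun π : ∀ s, 𝒴 s =>
        ((x (ofLex s).2, (fun r : {r // r < s} => π r), π s) :
          𝒳 × (∀ r : {r : Fin T ×ₗ Fin n // r < s}, 𝒴 r) × 𝒴 s) := by
      fun_prop
    exact ((C.measurable_chan s).comp hm).ennreal_ofReal

/-- Given a transcript, the channel density is a product of one factor for each node. -/
theorem transcriptChan_eq_prod (C : BlackboardProtocol 𝒳 n T 𝒴 ν) (x : Fin n → 𝒳) (π : ∀ s, 𝒴 s) :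
    C.transcriptChan x π =
      ∏ i, ∏ t : Fin T, C.chan (toLex (t, i)) (x i) (fun r => π r) (π (toLex (t, i))) := by
  rw [transcriptChan, Finset.prod_comm, ← Fintype.prod_prod_type' (fun (t : Fin T) (i : Fin n) =>
    C.chan (toLex (t, i)) (x i) (fun r => π r) (π (toLex (t, i))))]
  exact Fintype.prod_equiv ofLex _ _ fun s => rfl

end BlackboardProtocol

/-! ### Posterior means -/

/-- The posterior mean of `g` given the observation `y`, for the prior `m` and the likelihood `c`. -/
noncomputable def postMean {Ω Y : Type*} [MeasurableSpace Ω] (m : Measure Ω) (c : Ω → Y → ℝ)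
    (g : Ω → ℝ) (y : Y) : ℝ :=
  (∫ x, g x * c x y ∂m) / ∫ x, c x y ∂m

/-- The joint law of the parameter and the observation, for the prior `m` and the likelihood `c`. -/
noncomputable def bayesJoint {Ω Y : Type*} [MeasurableSpace Ω] [MeasurableSpace Y] (m : Measure Ω)
    (ν : Measure Y) (c : Ω → Y → ℝ) : Measure (Ω × Y) :=
  (m.prod ν).withDensity fun z => ENNReal.ofReal (c z.1 z.2)

theorem fst_bayesJoint {Ω Y : Type*} [MeasurableSpace Ω] [MeasurableSpace Y] {m : Measure Ω}
    [SFinite m] {ν : Measure Y} [SFinite ν] {c : Ω → Y → ℝ} (hcm : Measurable (Function.uncurry c))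
    (hc1 : ∀ x, ∫⁻ y, ENNReal.ofReal (c x y) ∂ν = 1) : (bayesJoint m ν c).fst = m := by
  ext A hA
  have hcm' : Measurable fun z : Ω × Y => ENNReal.ofReal (c z.1 z.2) := hcm.ennreal_ofReal
  rw [Measure.fst_apply hA, bayesJoint, withDensity_apply _ (measurable_fst hA),
    ← lintegral_indicator (measurable_fst hA), lintegral_prod _
      (hcm'.indicator (measurable_fst hA)).aemeasurable, ← lintegral_indicator_one hA]
  refine lintegral_congr fun x => ?_
  by_cases hx : x ∈ A
  · simp only [Set.indicator, Set.mem_preimage, hx, if_true, hc1, Pi.one_apply]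
  · simp only [Set.indicator, Set.mem_preimage, hx, if_false, lintegral_zero]

/-- This also holds where the marginal likelihood vanishes and the quotient takes its default value
`0`: then the likelihood is zero almost everywhere, and so is the numerator's integrand. -/
theorem integral_likelihood_mul_postMean {Ω Y : Type*} [MeasurableSpace Ω] {m : Measure Ω}
    {c : Ω → Y → ℝ} (hc0 : ∀ x y, 0 ≤ c x y) {y : Y}
    (hy : Integrable (fun x => c x y) m) (g : Ω → ℝ) :
    (∫ x, c x y ∂m) * postMean m c g y = ∫ x, g x * c x y ∂m := by
  rw [postMean]
  by_cases h0 : ∫ x, c x y ∂m = 0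
  · rw [h0, zero_mul]
    rw [integral_eq_zero_iff_of_nonneg (fun x => hc0 x y) hy] at h0
    symm
    apply integral_eq_zero_of_ae
    filter_upwards [h0] with x hx
    simp only [Pi.zero_apply] at hx ⊢
    rw [hx, mul_zero]
  · field_simp

/-- Conditional Jensen: the unnormalised posterior variance of `g` is nonnegative. -/
theorem postMean_sq_mul_le {Ω Y : Type*} [MeasurableSpace Ω] {m : Measure Ω} {c : Ω → Y → ℝ}
    (hc0 : ∀ x y, 0 ≤ c x y) {y : Y} (hy : Integrable (fun x => c x y) m)
    {g : Ω → ℝ} (hg1 : Integrable (fun x => g x * c x y) m)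
    (hg2 : Integrable (fun x => g x ^ 2 * c x y) m) :
    (∫ x, c x y ∂m) * postMean m c g y ^ 2 ≤ ∫ x, g x ^ 2 * c x y ∂m := by
  set M := postMean m c g y
  have h0 : 0 ≤ ∫ x, (g x - M) ^ 2 * c x y ∂m :=
    integral_nonneg fun x => mul_nonneg (sq_nonneg _) (hc0 x y)
  have h1 : ∀ x, (g x - M) ^ 2 * c x y = g x ^ 2 * c x y - 2 * M * (g x * c x y)
      + M ^ 2 * c x y := fun x => by ring
  have h2 : Integrable (fun x => g x ^ 2 * c x y - 2 * M * (g x * c x y)) m :=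
    hg2.sub (hg1.const_mul _)
  simp_rw [h1] at h0
  rw [integral_add h2 (hy.const_mul _),
    integral_sub hg2 (hg1.const_mul _), integral_const_mul, integral_const_mul,
    ← integral_likelihood_mul_postMean hc0 hy g] at h0
  change 0 ≤ _ - 2 * M * (_ * M) + _ at h0
  linarith

section Posterior

variable {Ω Y : Type*} [MeasurableSpace Ω] [MeasurableSpace Y] {m : Measure Ω}
  [IsProbabilityMeasure m] {ν : Measure Y} [SigmaFinite ν] {c : Ω → Y → ℝ}

theorem ae_integrable_likelihood (hc0 : ∀ x y, 0 ≤ c x y) (hcm : Measurable (Function.uncurry c))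
    (hc1 : ∀ x, ∫⁻ y, ENNReal.ofReal (c x y) ∂ν = 1) : ∀ᵐ y ∂ν, Integrable (fun x => c x y) m := by
  have hm : Measurable fun z : Y × Ω => ENNReal.ofReal (c z.2 z.1) :=
    (hcm.comp measurable_swap).ennreal_ofReal
  have h : ∀ᵐ y ∂ν, ∫⁻ x, ENNReal.ofReal (c x y) ∂m < ∞ := by
    refine ae_lt_top hm.lintegral_prod_right' ?_
    rw [lintegral_lintegral_swap hm.aemeasurable]
    simp [hc1]
  filter_upwards [h] with y hy
  refine ⟨(hcm.comp (measurable_id.prodMk measurable_const)).aestronglyMeasurable, ?_⟩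
  rwa [hasFiniteIntegral_iff_ofReal (ae_of_all _ fun x => hc0 x y)]

theorem measurable_integral_mul_likelihood (hcm : Measurable (Function.uncurry c)) {g : Ω → ℝ}
    (hg : Measurable g) : Measurable fun y => ∫ x, g x * c x y ∂m := by
  have : StronglyMeasurable fun z : Y × Ω => g z.2 * c z.2 z.1 :=
    ((hg.comp measurable_snd).mul (hcm.comp measurable_swap)).stronglyMeasurable
  exact this.integral_prod_right'.measurable

theorem measurable_integral_likelihood (hcm : Measurable (Function.uncurry c)) :
    Measurable fun y => ∫ x, c x y ∂m := by
  simpa using measurable_integral_mul_likelihood (m := m) hcm (measurable_const (a := (1 : ℝ)))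

theorem measurable_postMean (hcm : Measurable (Function.uncurry c)) {g : Ω → ℝ}
    (hg : Measurable g) : Measurable (postMean m c g) :=
  (measurable_integral_mul_likelihood hcm hg).div (measurable_integral_likelihood hcm)

theorem snd_bayesJoint (hc0 : ∀ x y, 0 ≤ c x y) (hcm : Measurable (Function.uncurry c))
    (hc1 : ∀ x, ∫⁻ y, ENNReal.ofReal (c x y) ∂ν = 1) :
    (bayesJoint m ν c).snd = ν.withDensity fun y => ENNReal.ofReal (∫ x, c x y ∂m) := by
  ext A hA
  have hcm' : Measurable fun z : Ω × Y => ENNReal.ofReal (c z.1 z.2) := hcm.ennreal_ofReal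
  rw [Measure.snd_apply hA, bayesJoint, withDensity_apply _ (measurable_snd hA),
    ← lintegral_indicator (measurable_snd hA), lintegral_prod_symm _
      (hcm'.indicator (measurable_snd hA)).aemeasurable, withDensity_apply _ hA,
    ← lintegral_indicator hA]
  refine lintegral_congr_ae ?_
  filter_upwards [ae_integrable_likelihood (m := m) hc0 hcm hc1] with y hy
  by_cases hx : y ∈ A
  · simp only [Set.indicator, Set.mem_preimage, hx, if_true]
    exact (ofReal_integral_eq_lintegral_ofReal hy (ae_of_all _ fun x => hc0 x y)).symm
  · simp only [Set.indicator, Set.mem_preimage, hx, if_false, lintegral_zero]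

theorem isProbabilityMeasure_bayesJoint (hcm : Measurable (Function.uncurry c))
    (hc1 : ∀ x, ∫⁻ y, ENNReal.ofReal (c x y) ∂ν = 1) : IsProbabilityMeasure (bayesJoint m ν c) := by
  refine ⟨?_⟩
  rw [← Measure.fst_univ, fst_bayesJoint hcm hc1, measure_univ]

theorem integral_snd_bayesJoint (hc0 : ∀ x y, 0 ≤ c x y) (hcm : Measurable (Function.uncurry c))
    (hc1 : ∀ x, ∫⁻ y, ENNReal.ofReal (c x y) ∂ν = 1) (h : Y → ℝ) :
    ∫ y, h y ∂(bayesJoint m ν c).snd = ∫ y, (∫ x, c x y ∂m) * h y ∂ν := by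
  rw [snd_bayesJoint hc0 hcm hc1, integral_withDensity_eq_integral_toReal_smul
    (measurable_integral_likelihood hcm).ennreal_ofReal (ae_of_all _ fun _ => ENNReal.ofReal_lt_top)]
  refine integral_congr_ae (ae_of_all _ fun y => ?_)
  simp only [smul_eq_mul]
  rw [ENNReal.toReal_ofReal (integral_nonneg fun x => hc0 x y)]

/-- The tower property of the posterior mean. -/
theorem integral_mul_bayesJoint (hc0 : ∀ x y, 0 ≤ c x y) (hcm : Measurable (Function.uncurry c))
    (hc1 : ∀ x, ∫⁻ y, ENNReal.ofReal (c x y) ∂ν = 1) {g : Ω → ℝ} {h : Y → ℝ}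
    (hint : Integrable (fun z => h z.2 * g z.1) (bayesJoint m ν c)) :
    ∫ z, h z.2 * g z.1 ∂(bayesJoint m ν c) =
      ∫ y, h y * postMean m c g y ∂(bayesJoint m ν c).snd := by
  have hcm' : Measurable fun z : Ω × Y => ENNReal.ofReal (c z.1 z.2) := hcm.ennreal_ofReal
  rw [integral_snd_bayesJoint hc0 hcm hc1]
  rw [bayesJoint, integrable_withDensity_iff hcm' (ae_of_all _ fun _ => ENNReal.ofReal_lt_top)]
    at hint
  rw [bayesJoint, integral_withDensity_eq_integral_toReal_smul hcm'
    (ae_of_all _ fun _ => ENNReal.ofReal_lt_top)]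
  simp only [ENNReal.toReal_ofReal (hc0 _ _), smul_eq_mul] at hint ⊢
  rw [integral_prod_symm _ (by simpa only [mul_comm] using hint)]
  refine integral_congr_ae ?_
  filter_upwards [ae_integrable_likelihood (m := m) hc0 hcm hc1] with y hy
  rw [mul_left_comm, integral_likelihood_mul_postMean hc0 hy, ← integral_const_mul]
  refine integral_congr_ae (ae_of_all _ fun x => ?_)
  simp only
  ring

theorem integrable_comp_fst_bayesJoint (hcm : Measurable (Function.uncurry c))
    (hc1 : ∀ x, ∫⁻ y, ENNReal.ofReal (c x y) ∂ν = 1) {g : Ω → ℝ} (hg : Integrable g m) :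
    Integrable (fun z => g z.1) (bayesJoint m ν c) := by
  rw [← fst_bayesJoint (m := m) hcm hc1] at hg
  exact hg.comp_measurable measurable_fst

theorem integral_comp_fst_bayesJoint (hcm : Measurable (Function.uncurry c))
    (hc1 : ∀ x, ∫⁻ y, ENNReal.ofReal (c x y) ∂ν = 1) {g : Ω → ℝ} (hg : Integrable g m) :
    ∫ z, g z.1 ∂(bayesJoint m ν c) = ∫ x, g x ∂m := by
  have h1 : AEStronglyMeasurable g ((bayesJoint m ν c).map Prod.fst) := by
    have := fst_bayesJoint (m := m) hcm hc1
    rw [Measure.fst] at this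
    rw [this]
    exact hg.1
  rw [← integral_map measurable_fst.aemeasurable h1]
  congr 1
  exact fst_bayesJoint hcm hc1

theorem ae_integrable_mul_likelihood (hc0 : ∀ x y, 0 ≤ c x y)
    (hcm : Measurable (Function.uncurry c))
    (hc1 : ∀ x, ∫⁻ y, ENNReal.ofReal (c x y) ∂ν = 1) {g : Ω → ℝ} (hg : Integrable g m) :
    ∀ᵐ y ∂ν, Integrable (fun x => g x * c x y) m := by
  have hcm' : Measurable fun z : Ω × Y => ENNReal.ofReal (c z.1 z.2) := hcm.ennreal_ofReal
  have h := integrable_comp_fst_bayesJoint hcm hc1 hg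
  rw [bayesJoint, integrable_withDensity_iff hcm' (ae_of_all _ fun _ => ENNReal.ofReal_lt_top)] at h
  simp only [ENNReal.toReal_ofReal (hc0 _ _)] at h
  exact h.prod_left_ae

theorem memLp_two_postMean (hc0 : ∀ x y, 0 ≤ c x y) (hcm : Measurable (Function.uncurry c))
    (hc1 : ∀ x, ∫⁻ y, ENNReal.ofReal (c x y) ∂ν = 1) {g : Ω → ℝ} (hgm : Measurable g)
    (hg : MemLp g 2 m) : MemLp (postMean m c g) 2 (bayesJoint m ν c).snd := by
  have hpm := measurable_postMean (m := m) hcm hgm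
  rw [memLp_two_iff_integrable_sq hpm.aestronglyMeasurable, snd_bayesJoint hc0 hcm hc1,
    integrable_withDensity_iff (measurable_integral_likelihood hcm).ennreal_ofReal
    (ae_of_all _ fun _ => ENNReal.ofReal_lt_top)]
  have hcm' : Measurable fun z : Ω × Y => ENNReal.ofReal (c z.1 z.2) := hcm.ennreal_ofReal
  have h2 := integrable_comp_fst_bayesJoint hcm hc1 hg.integrable_sq
  rw [bayesJoint, integrable_withDensity_iff hcm' (ae_of_all _ fun _ => ENNReal.ofReal_lt_top)] at h2
  simp only [ENNReal.toReal_ofReal (hc0 _ _)] at h2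
  refine h2.integral_prod_right.mono' ?_ ?_
  · exact ((hpm.pow_const 2).mul
      (measurable_integral_likelihood hcm).ennreal_ofReal.ennreal_toReal).aestronglyMeasurable
  · filter_upwards [ae_integrable_likelihood (m := m) hc0 hcm hc1,
      ae_integrable_mul_likelihood hc0 hcm hc1 (hg.integrable one_le_two),
      ae_integrable_mul_likelihood hc0 hcm hc1 hg.integrable_sq] with y hy1 hy2 hy3
    rw [ENNReal.toReal_ofReal (integral_nonneg fun x => hc0 x y), Real.norm_of_nonneg
      (mul_nonneg (sq_nonneg _) (integral_nonneg fun x => hc0 x y)), mul_comm]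
    exact postMean_sq_mul_le hc0 hy1 hy2 hy3

end Posterior

/-! ### Sub-Gaussian scores -/

/-- The difference between the moment generating function and its Gaussian bound is maximal at `0`,
where both equal `1`; its derivative there is the mean of `X`. -/
theorem ProbabilityTheory.HasSubgaussianMGF.integral_eq_zero {Ω : Type*} [MeasurableSpace Ω]
    {P : Measure Ω} [IsProbabilityMeasure P] {X : Ω → ℝ} {σ : ℝ≥0}
    (h : HasSubgaussianMGF X σ P) : ∫ x, X x ∂P = 0 := by
  have hd : HasDerivAt (mgf X P) (∫ x, X x ∂P) 0 := by
    simpa using hasDerivAt_mgf (X := X) (μ := P) (t := 0) (by simp [h.integrableExpSet_eq_univ])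
  have he : HasDerivAt (fun t : ℝ => Real.exp (σ * t ^ 2 / 2)) 0 0 := by
    have := ((((hasDerivAt_id (0 : ℝ)).pow 2).const_mul (σ : ℝ)).div_const 2).exp
    simpa using this
  have hmax : IsLocalMax (fun t => mgf X P t - Real.exp (σ * t ^ 2 / 2)) 0 := by
    refine Eventually.of_forall fun t => ?_
    have := h.mgf_le t
    simp only [mgf_zero]
    simpa using this
  simpa using hmax.hasDerivAt_eq_zero (hd.sub he)

/-- Sub-Gaussianity in the direction `w / ‖w‖`, evaluated at `λ = ‖w‖`. -/
theorem lintegral_exp_inner_le {d : ℕ} {𝒳 : Type*} [MeasurableSpace 𝒳] {P : Measure 𝒳}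
    [IsProbabilityMeasure P] {S : 𝒳 → EuclideanSpace ℝ (Fin d)} {N : ℝ≥0}
    (hS : ∀ u : EuclideanSpace ℝ (Fin d), ‖u‖ = 1 →
      HasSubgaussianMGF (fun x => inner ℝ u (S x)) (N ^ 2) P) (w : EuclideanSpace ℝ (Fin d)) :
    ∫⁻ x, ENNReal.ofReal (Real.exp (inner ℝ w (S x) - N ^ 2 * ‖w‖ ^ 2 / 2)) ∂P ≤ 1 := by
  by_cases hw : w = 0
  · simp [hw]
  have hn : ‖w‖ ≠ 0 := norm_ne_zero_iff.2 hw
  have hu := hS (‖w‖⁻¹ • w) (by rw [norm_smul, norm_inv, norm_norm, inv_mul_cancel₀ hn])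
  have hint := hu.integrable_exp_mul ‖w‖
  have hle := hu.mgf_le ‖w‖
  simp only [mgf, inner_smul_left, conj_trivial, mul_inv_cancel_left₀ hn] at hint hle
  rw [← ofReal_integral_eq_lintegral_ofReal _ (ae_of_all _ fun x => (Real.exp_pos _).le)]
  · rw [← ENNReal.ofReal_one]
    apply ENNReal.ofReal_le_ofReal
    simp_rw [Real.exp_sub]
    rw [integral_div, div_le_one (Real.exp_pos _)]
    simpa using hle
  · simp_rw [Real.exp_sub]
    exact hint.div_const _

theorem hasSubgaussianMGF_coord {d : ℕ} {𝒳 : Type*} [MeasurableSpace 𝒳] {P : Measure 𝒳}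
    {S : 𝒳 → EuclideanSpace ℝ (Fin d)} {N : ℝ≥0}
    (hS : ∀ u : EuclideanSpace ℝ (Fin d), ‖u‖ = 1 →
      HasSubgaussianMGF (fun x => inner ℝ u (S x)) (N ^ 2) P) (j : Fin d) :
    HasSubgaussianMGF (fun x => S x j) (N ^ 2) P := by
  have := hS (EuclideanSpace.single j 1) (by simp)
  simpa [EuclideanSpace.inner_single_left] using this

/-! ### Independence under product priors and likelihoods -/

section Product

variable {𝒳 : Type*} [MeasurableSpace 𝒳] {P : Measure 𝒳} [IsProbabilityMeasure P] {n : ℕ}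

theorem integral_mul_mul_prod (k : Fin n → 𝒳 → ℝ) {i l : Fin n} (hil : i ≠ l) (a b : 𝒳 → ℝ) :
    ∫ x : Fin n → 𝒳, a (x i) * b (x l) * ∏ r, k r (x r) ∂(Measure.pi fun _ => P) =
      (∫ z, a z * k i z ∂P) * (∫ z, b z * k l z ∂P) *
        ∏ r ∈ (Finset.univ.erase i).erase l, ∫ z, k r z ∂P := by
  set f : Fin n → 𝒳 → ℝ := fun r z =>
    (if r = i then a z else 1) * ((if r = l then b z else 1) * k r z) with hf
  have hl : l ∈ Finset.univ.erase i := Finset.mem_erase.2 ⟨hil.symm, Finset.mem_univ _⟩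
  have h1 : ∀ x : Fin n → 𝒳, a (x i) * b (x l) * ∏ r, k r (x r) = ∏ r, f r (x r) := by
    intro x
    simp only [hf, Finset.prod_mul_distrib, Finset.prod_ite_eq', Finset.mem_univ, if_true]
    rw [mul_assoc]
  simp_rw [h1]
  rw [integral_fintype_prod_eq_prod, ← Finset.mul_prod_erase _ _ (Finset.mem_univ i),
    ← Finset.mul_prod_erase _ _ hl, ← mul_assoc]
  congr 1
  · simp [hf, hil, hil.symm]
  · refine Finset.prod_congr rfl fun r hr => ?_
    have hrl := Finset.ne_of_mem_erase hr
    have hri := Finset.ne_of_mem_erase (Finset.mem_of_mem_erase hr)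
    simp [hf, hrl, hri]

/-- Under a product prior and a product likelihood, the coordinates are independent under the
posterior. -/
theorem postMean_mul_postMean {Y : Type*} {c : (Fin n → 𝒳) → Y → ℝ} {k : Fin n → 𝒳 → Y → ℝ}
    (hck : ∀ x y, c x y = ∏ i, k i (x i) y) {i l : Fin n} (hil : i ≠ l) (a b : 𝒳 → ℝ) (y : Y) :
    postMean (Measure.pi fun _ => P) c (fun x => a (x i)) y *
      postMean (Measure.pi fun _ => P) c (fun x => b (x l)) y =
    postMean (Measure.pi fun _ => P) c (fun x => a (x i) * b (x l)) y := by
  have h11 := integral_mul_mul_prod (P := P) (fun r z => k r z y) hil (fun _ => 1) (fun _ => 1)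
  have ha1 := integral_mul_mul_prod (P := P) (fun r z => k r z y) hil a (fun _ => 1)
  have h1b := integral_mul_mul_prod (P := P) (fun r z => k r z y) hil (fun _ => 1) b
  have hab := integral_mul_mul_prod (P := P) (fun r z => k r z y) hil a b
  simp only [one_mul, mul_one] at h11 ha1 h1b
  simp only [postMean, hck]
  rw [h11, ha1, h1b, hab]
  generalize (∏ r ∈ (Finset.univ.erase i).erase l, ∫ z, k r z y ∂P) = R
  generalize (∫ z, k i z y ∂P) = A
  generalize (∫ z, k l z y ∂P) = B
  -- If the marginal likelihood is zero, every posterior mean takes the default value `0` and both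
  -- sides vanish.
  by_cases h : A * B * R = 0
  · simp [h]
  · have hA : A ≠ 0 := by rintro rfl; simp at h
    have hB : B ≠ 0 := by rintro rfl; simp at h
    have hR : R ≠ 0 := by rintro rfl; simp at h
    field_simp

theorem memLp_comp_eval {p : ℝ≥0∞} {g : 𝒳 → ℝ} (hg : MemLp g p P) (i : Fin n) :
    MemLp (fun x : Fin n → 𝒳 => g (x i)) p (Measure.pi fun _ => P) :=
  hg.comp_measurePreserving (measurePreserving_eval (fun _ : Fin n => P) i)

end Product

/-! ### The information inequality -/

section Information

variable {d n : ℕ} {𝒳 Y : Type*} [MeasurableSpace 𝒳] [MeasurableSpace Y] {P : Measure 𝒳}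
  [IsProbabilityMeasure P] {ν : Measure Y} [SigmaFinite ν] {c : (Fin n → 𝒳) → Y → ℝ}

/-- Conditional independence turns the product into the posterior mean of `a (x i) * b (x l)`. The
tower property then removes the conditioning, and independence under the prior leaves a factor `∫ a
= 0`. -/
theorem integral_postMean_mul_postMean (hc0 : ∀ x y, 0 ≤ c x y)
    (hcm : Measurable (Function.uncurry c)) (hc1 : ∀ x, ∫⁻ y, ENNReal.ofReal (c x y) ∂ν = 1)
    {k : Fin n → 𝒳 → Y → ℝ} (hck : ∀ x y, c x y = ∏ i, k i (x i) y) {i l : Fin n} (hil : i ≠ l)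
    {a b : 𝒳 → ℝ} (ha : MemLp a 2 P) (hb : MemLp b 2 P) (ha0 : ∫ z, a z ∂P = 0) :
    ∫ y, postMean (Measure.pi fun _ => P) c (fun x => a (x i)) y *
      postMean (Measure.pi fun _ => P) c (fun x => b (x l)) y
      ∂(bayesJoint (Measure.pi fun _ => P) ν c).snd = 0 := by
  simp_rw [postMean_mul_postMean hck hil]
  have hint : Integrable (fun x : Fin n → 𝒳 => a (x i) * b (x l)) (Measure.pi fun _ => P) :=
    (memLp_comp_eval ha i).integrable_mul (memLp_comp_eval hb l)
  have h1 := integral_mul_bayesJoint (m := Measure.pi fun _ => P) (h := fun _ => 1)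
    (g := fun x : Fin n → 𝒳 => a (x i) * b (x l)) hc0 hcm hc1
    (by simpa using integrable_comp_fst_bayesJoint hcm hc1 hint)
  simp only [one_mul] at h1
  rw [← h1, integral_comp_fst_bayesJoint hcm hc1 hint]
  have h2 := integral_mul_mul_prod (P := P) (fun _ _ => 1) hil a b
  simpa [ha0] using h2

theorem sum_integral_sq_sum_postMean_le {S : 𝒳 → EuclideanSpace ℝ (Fin d)} {N : ℝ≥0}
    (hSm : Measurable S)
    (hS : ∀ u : EuclideanSpace ℝ (Fin d), ‖u‖ = 1 →
      HasSubgaussianMGF (fun x => inner ℝ u (S x)) (N ^ 2) P) (hc0 : ∀ x y, 0 ≤ c x y)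
    (hcm : Measurable (Function.uncurry c)) (hc1 : ∀ x, ∫⁻ y, ENNReal.ofReal (c x y) ∂ν = 1)
    {k : Fin n → 𝒳 → Y → ℝ} (hck : ∀ x y, c x y = ∏ i, k i (x i) y) :
    ENNReal.ofReal (∑ j, ∫ y, (∑ i, postMean (Measure.pi fun _ => P) c (fun x => S (x i) j) y) ^ 2
      ∂(bayesJoint (Measure.pi fun _ => P) ν c).snd) ≤
    2 * (N : ℝ≥0∞) ^ 2 * mutualInfo (bayesJoint (Measure.pi fun _ => P) ν c) := by
  set m : Measure (Fin n → 𝒳) := Measure.pi fun _ => P with hm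
  set V : Fin n → Fin d → Y → ℝ := fun i j => postMean m c (fun x => S (x i) j) with hV
  set ρ := bayesJoint m ν c with hρ
  have hρprob : IsProbabilityMeasure ρ := isProbabilityMeasure_bayesJoint hcm hc1
  have hSj : ∀ j, Measurable fun x => S x j := fun j => by fun_prop
  have hsub := fun j => hasSubgaussianMGF_coord hS j
  have hS2 : ∀ j, MemLp (fun x => S x j) 2 P := fun j => (hsub j).memLp 2
  have hSi2 : ∀ i j, MemLp (fun x : Fin n → 𝒳 => S (x i) j) 2 m := fun i j =>
    memLp_comp_eval (hS2 j) i
  have hSim : ∀ i j, Measurable fun x : Fin n → 𝒳 => S (x i) j := fun i j =>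
    (hSj j).comp (measurable_pi_apply i)
  have hVm : ∀ i j, Measurable (V i j) := fun i j => measurable_postMean hcm (hSim i j)
  have hV2 : ∀ i j, MemLp (V i j) 2 ρ.snd := fun i j =>
    memLp_two_postMean hc0 hcm hc1 (hSim i j) (hSi2 i j)
  have hVV2 : ∀ i l j, Integrable (fun y => V i j y * V l j y) ρ.snd := fun i l j =>
    (hV2 i j).integrable_mul (hV2 l j)
  have hsq : ∀ j, ∫ y, (∑ i, V i j y) ^ 2 ∂ρ.snd = ∑ i, ∫ y, V i j y ^ 2 ∂ρ.snd := by
    intro j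
    simp_rw [sq, Finset.sum_mul_sum]
    rw [integral_finsetSum _ fun i _ => integrable_finsetSum _ fun l _ => hVV2 i l j]
    refine Finset.sum_congr rfl fun i _ => ?_
    rw [integral_finsetSum _ fun l _ => hVV2 i l j,
      Finset.sum_eq_single i]
    · exact fun l _ hl => integral_postMean_mul_postMean hc0 hcm hc1 hck hl.symm (hS2 j) (hS2 j)
        (hsub j).integral_eq_zero
    · simp
  change ENNReal.ofReal (∑ j, ∫ y, (∑ i, V i j y) ^ 2 ∂ρ.snd) ≤ _
  simp_rw [hsq]
  set D := ∑ j, ∑ i, ∫ y, V i j y ^ 2 ∂ρ.snd with hD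
  -- For `N = 0` the score vanishes almost surely, so the left side is zero even if the mutual
  -- information is infinite.
  rcases eq_or_ne N 0 with rfl | hN
  · have hV0 : ∀ i j y, V i j y = 0 := by
      intro i j y
      have h1 : (fun x => S x j) =ᵐ[P] 0 := by
        have := hsub j
        simp only [ne_eq, OfNat.ofNat_ne_zero, not_false_eq_true, zero_pow] at this
        exact this.ae_eq_zero_of_hasSubgaussianMGF_zero
      have h2 : ∀ᵐ x ∂m, S (x i) j = 0 :=
        (measurePreserving_eval (fun _ : Fin n => P) i).quasiMeasurePreserving.ae h1
      have h3 : ∫ x, S (x i) j * c x y ∂m = 0 := by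
        apply integral_eq_zero_of_ae
        filter_upwards [h2] with x hx
        simp [hx]
      simp only [hV, postMean, h3, zero_div]
    simp [hD, hV0]
  have hNpos : (0 : ℝ) < N := by positivity
  -- The choice `w = V / N²` maximises `⟨w, V⟩ - N² ‖w‖² / 2`, with value `‖V‖² / (2N²)`.
  set φ : (Fin n → 𝒳) × Y → ℝ := fun z => ∑ i, ∑ j,
    (V i j z.2 * (S (z.1 i) j / N ^ 2) - V i j z.2 ^ 2 / (2 * N ^ 2)) with hφ
  have hVS : ∀ i j, Integrable (fun z : (Fin n → 𝒳) × Y => V i j z.2 * (S (z.1 i) j / N ^ 2)) ρ := by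
    intro i j
    have h1 : MemLp (fun z : (Fin n → 𝒳) × Y => V i j z.2) 2 ρ :=
      (hV2 i j).comp_measurePreserving ⟨measurable_snd, rfl⟩
    have h2 : MemLp (fun z : (Fin n → 𝒳) × Y => S (z.1 i) j) 2 ρ :=
      (hSi2 i j).comp_measurePreserving ⟨measurable_fst, fst_bayesJoint hcm hc1⟩
    have h3 := (h1.integrable_mul h2).div_const ((N : ℝ) ^ 2)
    simpa only [Pi.mul_apply, mul_div_assoc] using h3
  have hVV : ∀ i j, Integrable (fun z : (Fin n → 𝒳) × Y => V i j z.2 ^ 2 / (2 * N ^ 2)) ρ :=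
    fun i j => ((hV2 i j).comp_measurePreserving
      (⟨measurable_snd, rfl⟩ : MeasurePreserving Prod.snd ρ ρ.snd)).integrable_sq.div_const _
  have hterm : ∀ i j, Integrable (fun z : (Fin n → 𝒳) × Y =>
      V i j z.2 * (S (z.1 i) j / N ^ 2) - V i j z.2 ^ 2 / (2 * N ^ 2)) ρ := fun i j =>
    (hVS i j).sub (hVV i j)
  have hφint : Integrable φ ρ :=
    integrable_finsetSum _ fun i _ => integrable_finsetSum _ fun j _ => hterm i j
  have hφm : Measurable φ := by
    refine Finset.measurable_fun_sum _ fun i _ => Finset.measurable_fun_sum _ fun j _ => ?_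
    have h1 : Measurable fun z : (Fin n → 𝒳) × Y => V i j z.2 := (hVm i j).comp measurable_snd
    have h2 : Measurable fun z : (Fin n → 𝒳) × Y => S (z.1 i) j := (hSim i j).comp measurable_fst
    exact (h1.mul (h2.div_const _)).sub ((h1.pow_const 2).div_const _)
  have hval : ∫ z, φ z ∂ρ = D / (2 * N ^ 2) := by
    simp only [hφ]
    rw [integral_finsetSum _ fun i _ => integrable_finsetSum _ fun j _ => hterm i j, hD, Finset.sum_comm, Finset.sum_div]
    refine Finset.sum_congr rfl fun i _ => ?_
    rw [integral_finsetSum _ fun j _ => hterm i j, Finset.sum_div]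
    refine Finset.sum_congr rfl fun j _ => ?_
    rw [integral_sub (hVS i j) (hVV i j)]
    have e0 : Integrable (fun z : (Fin n → 𝒳) × Y => V i j z.2 * S (z.1 i) j) ρ := by
      have := (hVS i j).mul_const ((N : ℝ) ^ 2)
      refine this.congr (ae_of_all _ fun z => ?_)
      simp only
      field_simp
    have e1 : ∫ z, V i j z.2 * (S (z.1 i) j / N ^ 2) ∂ρ = (∫ y, V i j y ^ 2 ∂ρ.snd) / N ^ 2 := by
      simp_rw [← mul_div_assoc]
      rw [integral_div, integral_mul_bayesJoint hc0 hcm hc1 (g := fun x => S (x i) j) e0]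
      simp_rw [sq]
      rfl
    have e2 : ∫ z, V i j z.2 ^ 2 / (2 * N ^ 2) ∂ρ = (∫ y, V i j y ^ 2 ∂ρ.snd) / (2 * N ^ 2) := by
      rw [integral_div, Measure.snd, integral_map measurable_snd.aemeasurable
        ((hVm i j).pow_const 2).aestronglyMeasurable]
    rw [e1, e2]
    field_simp
    ring
  have hexp : ∫⁻ z, ENNReal.ofReal (Real.exp (φ z)) ∂(ρ.fst.prod ρ.snd) ≤ 1 := by
    have hfst : ρ.fst = m := fst_bayesJoint hcm hc1
    rw [hfst, lintegral_prod_symm _ hφm.exp.ennreal_ofReal.aemeasurable]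
    -- With `y` fixed, the `V i j y` are constants and the integral factors over the independent
    -- samples.
    have hone : ∀ y, ∫⁻ x, ENNReal.ofReal (Real.exp (φ (x, y))) ∂m ≤ 1 := by
      intro y
      set w : Fin n → EuclideanSpace ℝ (Fin d) := fun i =>
        WithLp.toLp 2 fun j => V i j y / N ^ 2 with hw
      have h1 : ∀ x : Fin n → 𝒳, ENNReal.ofReal (Real.exp (φ (x, y))) =
          ∏ i, ENNReal.ofReal (Real.exp (inner ℝ (w i) (S (x i)) - N ^ 2 * ‖w i‖ ^ 2 / 2)) := by
        intro x
        rw [← ENNReal.ofReal_prod_of_nonneg fun _ _ => (Real.exp_pos _).le, ← Real.exp_sum]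
        congr 2
        refine Finset.sum_congr rfl fun i _ => ?_
        rw [EuclideanSpace.real_norm_sq_eq, PiLp.inner_apply, Finset.mul_sum, Finset.sum_div,
          ← Finset.sum_sub_distrib]
        refine Finset.sum_congr rfl fun j _ => ?_
        simp only [hw, RCLike.inner_apply, conj_trivial]
        field_simp
      simp_rw [h1]
      rw [hm, lintegral_fintype_prod_eq_prod (fun _ : Fin n => P)
        (f := fun i z => ENNReal.ofReal (Real.exp (inner ℝ (w i) (S z) - N ^ 2 * ‖w i‖ ^ 2 / 2)))
        fun i => by fun_prop]
      exact Finset.prod_le_one' fun i _ => lintegral_exp_inner_le hS (w i)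
    calc _ ≤ ∫⁻ y, 1 ∂ρ.snd := lintegral_mono hone
      _ = 1 := by simp
  have hkl := ofReal_integral_le_klDiv ρ (ρ.fst.prod ρ.snd) hφm hφint hexp
  rw [hval] at hkl
  calc ENNReal.ofReal D = 2 * (N : ℝ≥0∞) ^ 2 * ENNReal.ofReal (D / (2 * N ^ 2)) := by
        have e : (2 * (N : ℝ≥0∞) ^ 2) = ENNReal.ofReal (2 * (N : ℝ) ^ 2) := by
          rw [ENNReal.ofReal_mul two_pos.le, ENNReal.ofReal_pow hNpos.le, ENNReal.ofReal_coe_nnreal]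
          simp
        rw [e, ← ENNReal.ofReal_mul (by positivity)]
        congr 1
        field_simp
    _ ≤ _ := by
        gcongr
        exact hkl

end Information

/-! ### The score as a logarithmic derivative of the square root density -/

/-- Where `q` is positive this is the chain rule. At a zero of `q`, the square root attains its
minimum, so its derivative vanishes and both sides are zero. -/
theorem deriv_log_mul_self_eq {q : ℝ → ℝ} {τ : ℝ} (hq : 0 ≤ q τ)
    (hd : DifferentiableAt ℝ (fun t => √(q t)) τ) :
    deriv (fun t => Real.log (q t)) τ * √(q τ) = 2 * deriv (fun t => √(q t)) τ := by
  rcases hq.eq_or_lt with h0 | hpos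
  · have hmin : IsLocalMin (fun t => √(q t)) τ := Eventually.of_forall fun t => by
      simp [← h0, Real.sqrt_nonneg]
    rw [hmin.deriv_eq_zero, ← h0]
    simp
  · have hs : 0 < √(q τ) := Real.sqrt_pos.2 hpos
    have hev : (fun t => Real.log (q t)) =ᶠ[𝓝 τ] fun t => 2 * Real.log √(q t) := by
      filter_upwards [hd.continuousAt.eventually (lt_mem_nhds hs)] with t ht
      rw [Real.log_sqrt (Real.sqrt_pos.1 ht).le]
      ring
    have hder := (hd.hasDerivAt.log hs.ne').const_mul 2
    rw [hev.deriv_eq, hder.deriv]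
    field_simp

namespace StatModel

variable {d : ℕ} {𝒳 : Type*} [MeasurableSpace 𝒳] {μ : Measure 𝒳}

theorem isProbabilityMeasure_law (M : StatModel d μ) {θ : EuclideanSpace ℝ (Fin d)} (hθ : θ ∈ M.Θ) :
    IsProbabilityMeasure (M.law θ) := by
  refine ⟨?_⟩
  rw [law, withDensity_apply _ MeasurableSet.univ, Measure.restrict_univ]
  exact M.lintegral_p θ hθ

theorem lintegral_sq_deriv_sqrt_le (M : StatModel d μ) (h_sqrt : M.RegularSqrt)
    (h_fisher : M.RegularFisher) {θ : EuclideanSpace ℝ (Fin d)} (hθ : θ ∈ interior M.Θ)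
    (j : Fin d) :
    ∫⁻ x, ENNReal.ofReal
        (deriv (fun t : ℝ => √(M.p (θ + t • EuclideanSpace.single j 1) x)) 0 ^ 2) ∂μ ≤
      ENNReal.ofReal (∫ x, M.score θ x j ^ 2 ∂(M.law θ)) := by
  have hmem := interior_subset hθ
  have hpm : Measurable fun x => ENNReal.ofReal (M.p θ x) := (M.measurable_p θ hmem).ennreal_ofReal
  rw [ofReal_integral_eq_lintegral_ofReal (h_fisher θ hθ j).1 (ae_of_all _ fun x => sq_nonneg _),
    law, lintegral_withDensity_eq_lintegral_mul₀' hpm.aemeasurable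
      (h_fisher θ hθ j).1.1.aemeasurable.ennreal_ofReal]
  refine lintegral_mono_ae ?_
  filter_upwards [h_sqrt] with x hx
  have h1 := deriv_log_mul_self_eq (τ := 0)
    (q := fun t : ℝ => M.p (θ + t • EuclideanSpace.single j 1) x)
    (by simpa using M.nonneg_p θ hmem x) ((hx θ hθ j).differentiableAt one_ne_zero)
  have hnn := M.nonneg_p θ hmem x
  rw [Pi.mul_apply, ← ENNReal.ofReal_mul hnn]
  apply ENNReal.ofReal_le_ofReal
  have h2 : M.score θ x j = deriv (fun t : ℝ =>
    Real.log (M.p (θ + t • EuclideanSpace.single j 1) x)) 0 := rfl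
  rw [← h2] at h1
  simp only [zero_smul, add_zero] at h1
  have h3 : M.p θ x * M.score θ x j ^ 2 = (M.score θ x j * √(M.p θ x)) ^ 2 := by
    rw [mul_pow, Real.sq_sqrt hnn]
    ring
  rw [h3, h1]
  -- The sharp relation has a factor `1/4`, which is discarded.
  nlinarith [sq_nonneg (deriv (fun t : ℝ => √(M.p (θ + t • EuclideanSpace.single j 1) x)) 0)]

/-- The square root density along a coordinate line, reparametrized so as to be defined for all
times, has the regularity needed for differentiation of mixtures. -/
theorem exists_sqrt_curve (M : StatModel d μ) (h_sqrt : M.RegularSqrt)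
    (h_fisher : M.RegularFisher) {θ : EuclideanSpace ℝ (Fin d)} (hθ : θ ∈ interior M.Θ)
    (j : Fin d) :
    ∃ (r : ℝ) (u : ℝ → 𝒳 → ℝ) (K : ℝ≥0), 0 < r ∧ (∀ t, Measurable (u t)) ∧
      (∀ x, ContDiff ℝ 1 fun t => u t x) ∧ (∀ t, ∫⁻ x, ENNReal.ofReal (u t x ^ 2) ∂μ = 1) ∧
      (∀ s, ∫⁻ x, ENNReal.ofReal (deriv (fun t => u t x) s ^ 2) ∂μ ≤ K) ∧
      (∀ᵐ x ∂μ, ∀ t, u t x ^ 2 =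
        M.p (θ + (r * Real.sin (t / r)) • EuclideanSpace.single j 1) x) ∧
      (∀ᵐ x ∂μ, M.score θ x j * M.p θ x = 2 * (u 0 x * deriv (fun t => u t x) 0)) := by
  set e : EuclideanSpace ℝ (Fin d) := EuclideanSpace.single j 1 with he
  obtain ⟨ε, hε, hball⟩ := Metric.isOpen_iff.1 isOpen_interior θ hθ
  set I : ℝ → ℝ := fun t => ∫ x, (M.score (θ + t • e) x j) ^ 2 ∂(M.law (θ + t • e)) with hI
  -- Continuity of the Fisher information gives the uniform energy bound `I 0 + 1` near `θ`.
  obtain ⟨δ, hδ, hIδ⟩ : ∃ δ > 0, ∀ t : ℝ, |t| < δ → I t < I 0 + 1 := by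
    have hc : ContinuousAt I 0 := (h_fisher θ hθ j).2
    have := hc.eventually (gt_mem_nhds (lt_add_one (I 0)))
    obtain ⟨δ, hδ, h⟩ := Metric.eventually_nhds_iff.1 this
    exact ⟨δ, hδ, fun t ht => h (by simpa [Real.dist_eq] using ht)⟩
  set r := min ε δ / 2 with hr
  have hrpos : 0 < r := by positivity
  have hrε : r < ε := by have := min_le_left ε δ; linarith
  have hrδ : r < δ := by have := min_le_right ε δ; linarith
  -- `ψ` stays in `[-r, r]` for all times, has `|ψ'| ≤ 1`, and satisfies `ψ 0 = 0`, `ψ' 0 = 1`, so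
  -- neither the energy bound nor the derivative at `0` is affected.
  set ψ : ℝ → ℝ := fun t => r * Real.sin (t / r) with hψ
  have hψr : ∀ t, |ψ t| ≤ r := fun t => by
    rw [hψ, abs_mul, abs_of_pos hrpos]
    exact mul_le_of_le_one_right hrpos.le (Real.abs_sin_le_one _)
  have hψc : ContDiff ℝ 1 ψ := contDiff_const.mul (Real.contDiff_sin.comp (contDiff_id.div_const r))
  have hψd : ∀ t, HasDerivAt ψ (Real.cos (t / r)) t := fun t => by
    have := (((hasDerivAt_id t).div_const r).sin).const_mul r
    rwa [mul_comm (Real.cos _), ← mul_assoc, mul_one_div_cancel hrpos.ne', one_mul] at this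
  have hint : ∀ τ : ℝ, |τ| ≤ r → θ + τ • e ∈ interior M.Θ := fun τ hτ => by
    apply hball
    have hnorm : ‖e‖ = 1 := by simp [he]
    rw [Metric.mem_ball, dist_eq_norm, add_sub_cancel_left, norm_smul, hnorm, mul_one,
      Real.norm_eq_abs]
    exact hτ.trans_lt hrε
  -- Setting the curve to zero off a measurable conull set makes it `C¹` for every `x` while keeping
  -- it measurable.
  obtain ⟨A, hAsub, hAm, hA0⟩ : ∃ A : Set 𝒳, A ⊆ {x | ∀ θ ∈ interior M.Θ, ∀ j : Fin d,
      ContDiffAt ℝ 1 (fun t : ℝ => √(M.p (θ + t • EuclideanSpace.single j 1) x)) 0} ∧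
      MeasurableSet A ∧ ∀ᵐ x ∂μ, x ∈ A := by
    obtain ⟨B, hB, hBm, hB0⟩ := exists_measurable_superset_of_null (ae_iff.1 h_sqrt)
    refine ⟨Bᶜ, ?_, hBm.compl, compl_mem_ae_iff.2 hB0⟩
    intro x hx
    by_contra hcon
    exact hx (hB hcon)
  set f : 𝒳 → ℝ → ℝ := fun x τ => √(M.p (θ + τ • e) x) with hf
  have hshift : ∀ x (τ : ℝ), (fun t : ℝ => √(M.p (θ + τ • e + t • e) x)) = fun t => f x (τ + t) := by
    intro x τ
    funext t
    simp only [hf, add_smul, add_assoc]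
  have hfc : ∀ x ∈ A, ∀ τ, |τ| ≤ r → ContDiffAt ℝ 1 (f x) τ := by
    intro x hx τ hτ
    have h1 := hAsub hx (θ + τ • e) (hint τ hτ) j
    rw [← he, hshift] at h1
    have h2 : f x = (fun t => f x (τ + t)) ∘ fun t => t - τ := by
      funext t
      simp
    rw [h2]
    exact ContDiffAt.comp τ (by simpa using h1) (contDiffAt_id.sub contDiffAt_const)
  have hderiv0 : ∀ x τ, deriv (fun t : ℝ => √(M.p (θ + τ • e + t • e) x)) 0 = deriv (f x) τ := by
    intro x τ
    rw [hshift, deriv_comp_const_add, add_zero]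
  classical
  set u : ℝ → 𝒳 → ℝ := fun t x => if x ∈ A then f x (ψ t) else 0 with hu
  have huA : ∀ x ∈ A, (fun t => u t x) = f x ∘ ψ := fun x hx => by
    funext t
    simp [hu, hx]
  have huc : ∀ x, ContDiff ℝ 1 fun t => u t x := by
    intro x
    by_cases hx : x ∈ A
    · rw [huA x hx, contDiff_iff_contDiffAt]
      exact fun t => (hfc x hx _ (hψr t)).comp t hψc.contDiffAt
    · simp only [hu, hx, if_false]
      exact contDiff_const
  have hud : ∀ x ∈ A, ∀ s, deriv (fun t => u t x) s = deriv (f x) (ψ s) * Real.cos (s / r) := by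
    intro x hx s
    rw [huA x hx]
    exact (((hfc x hx _ (hψr s)).differentiableAt one_ne_zero).hasDerivAt.comp s (hψd s)).deriv
  have hmem : ∀ t, θ + ψ t • e ∈ M.Θ := fun t => interior_subset (hint _ (hψr t))
  have husq : ∀ x ∈ A, ∀ t, u t x ^ 2 = M.p (θ + ψ t • e) x := by
    intro x hx t
    simp only [hu, hx, if_true, hf]
    exact Real.sq_sqrt (M.nonneg_p _ (hmem t) x)
  have hψ0 : ψ 0 = 0 := by simp [hψ]
  refine ⟨r, u, (I 0 + 1).toNNReal, hrpos, ?_, huc, ?_, ?_, ?_, ?_⟩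
  · exact fun t => Measurable.ite hAm (M.measurable_p _ (hmem t)).sqrt measurable_const
  · intro t
    rw [← M.lintegral_p _ (hmem t)]
    refine lintegral_congr_ae ?_
    filter_upwards [hA0] with x hx
    rw [husq x hx]
  · intro s
    have h1 := M.lintegral_sq_deriv_sqrt_le h_sqrt h_fisher (hint _ (hψr s)) j
    rw [← he] at h1
    simp_rw [hderiv0] at h1
    calc ∫⁻ x, ENNReal.ofReal (deriv (fun t => u t x) s ^ 2) ∂μ
        ≤ ∫⁻ x, ENNReal.ofReal (deriv (f x) (ψ s) ^ 2) ∂μ := by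
          refine lintegral_mono_ae ?_
          filter_upwards [hA0] with x hx
          rw [hud x hx, mul_pow]
          apply ENNReal.ofReal_le_ofReal
          exact mul_le_of_le_one_right (sq_nonneg _) (Real.cos_sq_le_one _)
      _ ≤ ENNReal.ofReal (I (ψ s)) := h1
      _ ≤ ENNReal.ofReal (I 0 + 1) :=
          ENNReal.ofReal_le_ofReal (hIδ _ ((hψr s).trans_lt hrδ)).le
      _ = _ := rfl
  · filter_upwards [hA0] with x hx t
    exact husq x hx t
  · filter_upwards [hA0] with x hx
    have hnn := M.nonneg_p θ (interior_subset hθ) x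
    have h1 := deriv_log_mul_self_eq (τ := 0) (q := fun t : ℝ => M.p (θ + t • e) x)
      (by simpa using hnn) ((hfc x hx 0 (by simpa using hrpos.le)).differentiableAt one_ne_zero)
    have h2 : M.score θ x j = deriv (fun t : ℝ => Real.log (M.p (θ + t • e) x)) 0 := rfl
    rw [← h2] at h1
    simp only [zero_smul, add_zero] at h1
    have h3 : u 0 x = √(M.p θ x) := by simp [hu, hx, hf, hψ0]
    rw [hud x hx, hψ0, h3]
    simp only [zero_div, Real.cos_zero, mul_one]
    have h4 : deriv (f x) 0 = deriv (fun t : ℝ => √(M.p (θ + t • e) x)) 0 := rfl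
    rw [h4, mul_left_comm, ← h1, mul_left_comm, Real.mul_self_sqrt hnn]

/-- A measurable version of a score with sub-Gaussian marginals. -/
theorem exists_measurable_score (M : StatModel d μ) {θ : EuclideanSpace ℝ (Fin d)} {N : ℝ≥0}
    (h_sub : ∀ u : EuclideanSpace ℝ (Fin d), ‖u‖ = 1 →
      HasSubgaussianMGF (fun x => inner ℝ u (M.score θ x)) (N ^ 2) (M.law θ)) :
    ∃ S : 𝒳 → EuclideanSpace ℝ (Fin d), Measurable S ∧ M.score θ =ᵐ[M.law θ] S := by
  have hj : ∀ j, AEMeasurable (fun x => M.score θ x j) (M.law θ) := fun j =>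
    (hasSubgaussianMGF_coord h_sub j).aemeasurable
  refine ⟨fun x => WithLp.toLp 2 fun j => (hj j).mk _ x, ?_, ?_⟩
  · exact (WithLp.measurable_toLp 2 _).comp (measurable_pi_lambda _ fun j => (hj j).measurable_mk)
  · filter_upwards [ae_all_iff.2 fun j => (hj j).ae_eq_mk] with x hx
    ext j
    exact hx j

end StatModel

/-! ### The derivative of the transcript density -/

theorem ae_pi_of_ae {𝒳 : Type*} [MeasurableSpace 𝒳] {μ : Measure 𝒳} [SigmaFinite μ] {n : ℕ}
    {q : 𝒳 → Prop} (h : ∀ᵐ x ∂μ, q x) : ∀ᵐ x ∂(Measure.pi fun _ : Fin n => μ), ∀ i, q (x i) :=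
  ae_all_iff.2 fun i => (Measure.quasiMeasurePreserving_eval (fun _ : Fin n => μ) i).ae h

namespace BlackboardProtocol

variable {d n T : ℕ} {𝒳 : Type*} [MeasurableSpace 𝒳] {μ : Measure 𝒳} [SigmaFinite μ]
  {𝒴 : Fin T ×ₗ Fin n → Type*} [∀ s, MeasurableSpace (𝒴 s)] {ν : ∀ s, Measure (𝒴 s)}

theorem integral_pi_law (M : StatModel d μ) {θ : EuclideanSpace ℝ (Fin d)} (hθ : θ ∈ M.Θ)
    (g : (Fin n → 𝒳) → ℝ) :
    ∫ x, g x ∂(Measure.pi fun _ => M.law θ) =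
      ∫ x, g x * ∏ i, M.p θ (x i) ∂(Measure.pi fun _ => μ) := by
  have hP := M.isProbabilityMeasure_law hθ
  have hpm : Measurable fun x => ENNReal.ofReal (M.p θ x) := (M.measurable_p θ hθ).ennreal_ofReal
  have : ∀ _ : Fin n, SigmaFinite (μ.withDensity fun x => ENNReal.ofReal (M.p θ x)) := fun _ =>
    inferInstanceAs (SigmaFinite (M.law θ))
  have hprodm : Measurable fun x : Fin n → 𝒳 => ∏ i, ENNReal.ofReal (M.p θ (x i)) :=
    Finset.measurable_fun_prod _ fun i _ => hpm.comp (measurable_pi_apply i)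
  simp only [StatModel.law]
  rw [pi_withDensity (fun _ : Fin n => μ) (f := fun _ x => ENNReal.ofReal (M.p θ x)) fun _ => hpm,
    integral_withDensity_eq_integral_toReal_smul hprodm
      (ae_of_all _ fun x => ENNReal.prod_lt_top fun _ _ => ENNReal.ofReal_lt_top)]
  refine integral_congr_ae (ae_of_all _ fun x => ?_)
  simp only [smul_eq_mul, ENNReal.toReal_prod, ENNReal.toReal_ofReal (M.nonneg_p θ hθ _)]
  rw [mul_comm]

theorem transcriptDensity_eq (C : BlackboardProtocol 𝒳 n T 𝒴 ν) (M : StatModel d μ)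
    {θ : EuclideanSpace ℝ (Fin d)} (hθ : θ ∈ M.Θ) (π : ∀ s, 𝒴 s) :
    C.transcriptDensity M θ π =
      ∫ x, C.transcriptChan x π ∂(Measure.pi fun _ => M.law θ) := by
  rw [integral_pi_law M hθ, transcriptDensity]

theorem ae_hasDerivAt_transcriptDensity [∀ s, SigmaFinite (ν s)]
    (C : BlackboardProtocol 𝒳 n T 𝒴 ν) (M : StatModel d μ) (h_sqrt : M.RegularSqrt)
    (h_fisher : M.RegularFisher) (h_chan : C.SquareIntegrable M)
    {θ : EuclideanSpace ℝ (Fin d)} (hθ : θ ∈ interior M.Θ) (j : Fin d)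
    {S : 𝒳 → ℝ} (hSL : Integrable S (M.law θ))
    (hS : (fun x => M.score θ x j) =ᵐ[M.law θ] S) :
    ∀ᵐ π ∂(Measure.pi ν), HasDerivAt
      (fun t : ℝ => C.transcriptDensity M (θ + t • EuclideanSpace.single j 1) π)
      (∑ i, ∫ x, S (x i) * C.transcriptChan x π ∂(Measure.pi fun _ => M.law θ)) 0 := by
  obtain ⟨r, u, K, hr, hum, huc, hu1, huK, husq, hscore⟩ :=
    M.exists_sqrt_curve h_sqrt h_fisher hθ j
  have hmem := interior_subset hθ
  have hP := M.isProbabilityMeasure_law hmem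
  have hpm : Measurable fun x => ENNReal.ofReal (M.p θ x) :=
    (M.measurable_p θ hmem).ennreal_ofReal
  -- `S` equals the score only `P_θ`-almost surely; multiplication by the density makes the identity
  -- hold `μ`-almost everywhere.
  have hSp : ∀ᵐ x ∂μ, S x * M.p θ x = 2 * (u 0 x * deriv (fun t => u t x) 0) := by
    have h1 := (ae_withDensity_iff hpm).1 hS
    filter_upwards [h1, hscore] with x hx1 hx2
    rw [← hx2]
    by_cases h0 : M.p θ x = 0
    · simp [h0]
    · rw [hx1]
      simpa using lt_of_le_of_ne (M.nonneg_p θ hmem x) (Ne.symm h0)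
  have hsq : ∀ᵐ x ∂(Measure.pi fun _ : Fin n => μ), ∀ t, (∏ i, u t (x i)) ^ 2 =
      ∏ i, M.p (θ + (r * Real.sin (t / r)) • EuclideanSpace.single j 1) (x i) := by
    filter_upwards [ae_pi_of_ae husq] with x hx t
    rw [← Finset.prod_pow]
    exact Finset.prod_congr rfl fun i _ => hx i t
  have hsq0 : ∀ᵐ x ∂(Measure.pi fun _ : Fin n => μ), (∏ i, u 0 (x i)) ^ 2 = ∏ i, M.p θ (x i) := by
    filter_upwards [hsq] with x hx
    simpa using hx 0
  have hprod : ∀ᵐ x ∂(Measure.pi fun _ : Fin n => μ),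
      2 * ((∏ i, u 0 (x i)) * deriv (fun t => ∏ i, u t (x i)) 0) =
        (∑ i, S (x i)) * ∏ i, M.p θ (x i) := by
    filter_upwards [ae_pi_of_ae hSp, ae_pi_of_ae husq] with x hx hx2
    rw [deriv_prod_curve huc, Finset.mul_sum, Finset.mul_sum, Finset.sum_mul]
    refine Finset.sum_congr rfl fun i _ => ?_
    have h2 : ∀ i, M.p θ (x i) = u 0 (x i) ^ 2 := fun i => by simpa using (hx2 i 0).symm
    rw [← Finset.mul_prod_erase _ (fun i => u 0 (x i)) (Finset.mem_univ i),
      ← Finset.mul_prod_erase _ (fun i => M.p θ (x i)) (Finset.mem_univ i), ← mul_assoc (S (x i)),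
      hx i, Finset.prod_congr rfl fun k _ => h2 k, Finset.prod_pow]
    ring
  have key := ae_hasDerivAt_integral_mul_sq (m := Measure.pi fun _ : Fin n => μ)
    (ν := Measure.pi ν) (U := fun t x => ∏ i, u t (x i)) (K := n * (n * K))
    (c := C.transcriptChan) (measurable_prod_curve hum) (contDiff_prod_curve huc)
    (by rw [lintegral_sq_prod_curve hum 0 (hu1 0)]; exact ENNReal.one_ne_top)
    (fun s => lintegral_sq_deriv_prod_curve_le hum huc s (hu1 s) (huK s))
    C.transcriptChan_nonneg C.measurable_transcriptChan C.lintegral_transcriptChan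
    (by
      filter_upwards [h_chan θ hmem] with π hπ
      refine hπ.congr ?_
      filter_upwards [hsq0] with x hx
      rw [hx])
  have hSi : ∀ i, Integrable (fun x : Fin n → 𝒳 => S (x i)) (Measure.pi fun _ => M.law θ) :=
    fun i => (measurePreserving_eval (fun _ : Fin n => M.law θ) i).integrable_comp_of_integrable hSL
  have hint := ae_all_iff.2 fun i => ae_integrable_mul_likelihood (ν := Measure.pi ν)
    C.transcriptChan_nonneg C.measurable_transcriptChan C.lintegral_transcriptChan (hSi i)
  filter_upwards [key, hint] with π hπ hiπ
  have hval : 2 * ∫ x, C.transcriptChan x π * ((∏ i, u 0 (x i)) *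
      deriv (fun t => ∏ i, u t (x i)) 0) ∂(Measure.pi fun _ : Fin n => μ) =
      ∑ i, ∫ x, S (x i) * C.transcriptChan x π ∂(Measure.pi fun _ => M.law θ) := by
    rw [← integral_finsetSum _ fun i _ => hiπ i, integral_pi_law M hmem, ← integral_const_mul]
    refine integral_congr_ae ?_
    filter_upwards [hprod] with x hx
    rw [mul_left_comm, hx, ← Finset.sum_mul]
    ring
  have hfun : ∀ t : ℝ, ∫ x, C.transcriptChan x π * (∏ i, u t (x i)) ^ 2
      ∂(Measure.pi fun _ : Fin n => μ) = C.transcriptDensity M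
        (θ + (r * Real.sin (t / r)) • EuclideanSpace.single j 1) π := by
    intro t
    refine integral_congr_ae ?_
    filter_upwards [hsq] with x hx
    rw [hx t]
  rw [hval] at hπ
  simp_rw [hfun] at hπ
  -- Composition with the local inverse of `t ↦ r sin (t / r)` returns to the straight coordinate
  -- line.
  have harc : HasDerivAt (fun t : ℝ => r * Real.arcsin (t / r)) 1 0 := by
    have h1 : HasDerivAt Real.arcsin 1 ((0 : ℝ) / r) := by
      rw [zero_div]
      simpa using Real.hasDerivAt_arcsin (x := 0) (by norm_num) (by norm_num)
    have h2 := ((h1.comp (0 : ℝ) ((hasDerivAt_id (0 : ℝ)).div_const r))).const_mul r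
    rwa [one_mul, mul_one_div_cancel hr.ne'] at h2
  have h0 : r * Real.arcsin ((0 : ℝ) / r) = 0 := by simp
  have hcomp := HasDerivAt.comp (0 : ℝ) (h₂ := fun t : ℝ => C.transcriptDensity M
    (θ + (r * Real.sin (t / r)) • EuclideanSpace.single j 1) π) (by rw [h0]; exact hπ) harc
  rw [mul_one] at hcomp
  refine hcomp.congr_of_eventuallyEq ?_
  filter_upwards [Metric.ball_mem_nhds (0 : ℝ) hr] with t ht
  rw [Metric.mem_ball, Real.dist_eq, sub_zero, abs_lt] at ht
  have h1 : -1 ≤ t / r := by rw [le_div_iff₀ hr]; linarith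
  have h2 : t / r ≤ 1 := by rw [div_le_iff₀ hr]; linarith
  simp only [Function.comp_apply]
  rw [mul_div_cancel_left₀ _ hr.ne', Real.sin_arcsin h1 h2, mul_div_cancel₀ _ hr.ne']

end BlackboardProtocol

/-! ### The trace bound -/

theorem corollary1 {d n T : ℕ} {𝒳 : Type*} [MeasurableSpace 𝒳]
    (μ : Measure 𝒳) [SigmaFinite μ]
    {𝒴 : Fin T ×ₗ Fin n → Type*} [∀ s, MeasurableSpace (𝒴 s)]
    (ν : ∀ s, Measure (𝒴 s)) [∀ s, SigmaFinite (ν s)]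
    (M : StatModel d μ) (C : BlackboardProtocol 𝒳 n T 𝒴 ν)
    (h_sqrt : M.RegularSqrt) (h_fisher : M.RegularFisher) (h_chan : C.SquareIntegrable M)
    (θ : EuclideanSpace ℝ (Fin d)) (hθ : θ ∈ interior M.Θ) (N : ℝ≥0)
    (h_sub : ∀ u : EuclideanSpace ℝ (Fin d), ‖u‖ = 1 →
      HasSubgaussianMGF (fun x => inner ℝ u (M.score θ x)) (N ^ 2) (M.law θ)) :
    -- the Fisher information matrix of the transcript is well defined
    (∀ᵐ π ∂(C.transcriptLaw M θ), ∀ j : Fin d, LineDifferentiableAt ℝ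
      (fun θ' => Real.log (C.transcriptDensity M θ' π)) θ (EuclideanSpace.single j 1)) ∧
    (∀ j k : Fin d, Integrable (fun π =>
      gradLog (fun θ' => C.transcriptDensity M θ' π) θ j *
        gradLog (fun θ' => C.transcriptDensity M θ' π) θ k) (C.transcriptLaw M θ)) ∧
    -- the bound
    ENNReal.ofReal (C.transcriptFisher M θ).trace ≤
      2 * (N : ℝ≥0∞) ^ 2 * mutualInfo (C.jointLaw M θ) := by

  have hmem := interior_subset hθ
  have hP := M.isProbabilityMeasure_law hmem
  -- The score need not be measurable; sub-Gaussianity supplies almost everywhere measurability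
  -- under `P_θ`, hence a measurable version.
  obtain ⟨S, hSm, hSS⟩ := M.exists_measurable_score h_sub
  have hS : ∀ u : EuclideanSpace ℝ (Fin d), ‖u‖ = 1 →
      HasSubgaussianMGF (fun x => inner ℝ u (S x)) (N ^ 2) (M.law θ) := fun u hu =>
    (h_sub u hu).congr (by filter_upwards [hSS] with x hx; rw [hx])
  have hSj : ∀ j, MemLp (fun x => S x j) 2 (M.law θ) := fun j =>
    (hasSubgaussianMGF_coord hS j).memLp 2
  set m : Measure (Fin n → 𝒳) := Measure.pi fun _ => M.law θ with hm
  set V : Fin n → Fin d → (∀ s, 𝒴 s) → ℝ := fun i j =>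
    postMean m C.transcriptChan fun x => S (x i) j with hV
  have hc0 := C.transcriptChan_nonneg
  have hcm : Measurable (Function.uncurry C.transcriptChan) := C.measurable_transcriptChan
  have hc1 := C.lintegral_transcriptChan
  have hlaw : C.transcriptLaw M θ = (bayesJoint m (Measure.pi ν) C.transcriptChan).snd := rfl
  have hlaw' := snd_bayesJoint (m := m) hc0 hcm hc1
  -- The transcript law gives no mass to the zeros of its own density, so the logarithm can be
  -- differentiated almost surely.
  have hpos : ∀ᵐ π ∂(C.transcriptLaw M θ), 0 < C.transcriptDensity M θ π := by
    rw [hlaw, hlaw', ae_withDensity_iff (measurable_integral_likelihood hcm).ennreal_ofReal]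
    refine ae_of_all _ fun π hπ => ?_
    rw [C.transcriptDensity_eq M hmem]
    simpa using hπ
  have hac : C.transcriptLaw M θ ≪ Measure.pi ν := by
    rw [hlaw, hlaw']
    exact withDensity_absolutelyContinuous _ _
  have hder : ∀ᵐ π ∂(C.transcriptLaw M θ), ∀ j : Fin d, HasDerivAt (fun t : ℝ => Real.log
      (C.transcriptDensity M (θ + t • EuclideanSpace.single j 1) π)) (∑ i, V i j π) 0 := by
    have h1 := ae_all_iff.2 fun j => hac.ae_le (C.ae_hasDerivAt_transcriptDensity M h_sqrt h_fisher
      h_chan hθ j ((hSj j).integrable one_le_two) (by filter_upwards [hSS] with x hx; rw [hx]))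
    filter_upwards [h1, hpos] with π hπ hp j
    have h2 := (hπ j).log (by simpa using hp.ne')
    convert h2 using 1
    simp only [zero_smul, add_zero]
    rw [Finset.sum_div, C.transcriptDensity_eq M hmem]
    rfl
  have hgrad : ∀ᵐ π ∂(C.transcriptLaw M θ), ∀ j : Fin d,
      gradLog (fun θ' => C.transcriptDensity M θ' π) θ j = ∑ i, V i j π := by
    filter_upwards [hder] with π hπ j
    exact (hπ j).deriv
  have hV2 : ∀ j, MemLp (fun π => ∑ i, V i j π) 2 (C.transcriptLaw M θ) := fun j =>
    memLp_finsetSum _ fun i _ => memLp_two_postMean hc0 hcm hc1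
      (by fun_prop) (memLp_comp_eval (hSj j) i)
  refine ⟨?_, fun j k => ?_, ?_⟩
  · filter_upwards [hder] with π hπ j
    exact (hπ j).differentiableAt
  · refine ((hV2 j).integrable_mul (hV2 k)).congr ?_
    filter_upwards [hgrad] with π hπ
    rw [hπ j, hπ k, Pi.mul_apply]
  · have htrace : (C.transcriptFisher M θ).trace =
        ∑ j, ∫ π, (∑ i, V i j π) ^ 2 ∂(C.transcriptLaw M θ) := by
      simp only [BlackboardProtocol.transcriptFisher, fisherInfo, Matrix.trace, Matrix.diag_apply,
        Matrix.of_apply]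
      refine Finset.sum_congr rfl fun j _ => integral_congr_ae ?_
      filter_upwards [hgrad] with π hπ
      rw [hπ j, sq]
    rw [htrace]
    exact sum_integral_sq_sum_postMean_le hSm hS hc0 hcm hc1
      -- All messages written by node `i` are grouped together: given `π`, they depend on the
      -- samples through `x i` alone.
      (k := fun i z π => ∏ t : Fin T, C.chan (toLex (t, i)) z (fun r => π r) (π (toLex (t, i))))
      C.transcriptChan_eq_prod
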